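/- Let $N\ge 1$, $F,G\in\mathbb C^{N\times N}$, $\sigma\in\mathbb R$, and consider the memoryless channel $y=(F+sG)x+z$ on $\mathbb C^N$, where $x$, $s\sim\mathcal{CN}(0,\sigma^2)$ and $z\sim\mathcal{CN}(0,I_N)$ are independent. Logarithms are natural. For $P\ge 0$ let $C(P)=\sup I(x;y)$ over all input distributions with $\mathbb E\|x\|^2\le P$, and for $r\ge 0$ let $C(P,r)$ be the same supremum restricted to inputs supported in $\mathcal X(r)=\{x:\|x\|\le r\}$. For $Q\succeq 0$, $S\succ 0$, $0<\alpha\le N$ put $$\Sigma_y(Q)=I+FQF^H+\sigma^2GQG^H,\qquad \beta(Q,S)=\tfrac1\alpha\operatorname{tr}\big(S\,\Sigma_y(Q)\big),$$ $$\gamma(S,x)=\operatorname{tr}(S)+x^H\big(F^HSF+\sigma^2G^HSG\big)x,$$ $$R_{\mathrm{UB}}(\alpha,S,Q)=\alpha\log\beta(Q,S)+\log\frac{\Gamma(\alpha)}{\Gamma(N)}+\alpha-N-\log\det S+\sup_{x\in\mathcal X(r)}\log\frac{\gamma(S,x)^{N-\alpha}}{1+\sigma^2\|Gx\|^2}.$$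 Then: 1. $\displaystyle C(P,r)\le\max_{Q\succeq0,\ \operatorname{tr}Q\le P}\ \inf_{0<\alpha\le N,\ S\succ0}R_{\mathrm{UB}}(\alpha,S,Q)$, the maximum being attained. 2. For every $Q\succeq 0$ with $\operatorname{tr}Q\le P$, the choice $\alpha=N$, $S=\det(\Sigma_y(Q))^{1/N}\,\Sigma_y(Q)^{-1}\succ0$ gives $R_{\mathrm{UB}}(N,S,Q)=N\log\beta(Q,S)=\log\det\Sigma_y(Q)$. 3. $\displaystyle C(P)\le\max_{Q\succeq0,\ \operatorname{tr}Q\le P}\log\det\big(I+FQF^H+\sigma^2GQG^H\big)$, the maximum being attained. -/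

import Mathlib

open MeasureTheory ProbabilityTheory
open scoped ENNReal NNReal Matrix ComplexOrder

namespace DopplerChannel

noncomputable section

/-- `CN(0, v)` on `ℂ`: independent real and imaginary parts, each real Gaussian with mean `0` and
variance `v / 2`. -/
def complexGaussian (v : ℝ≥0) : Measure ℂ :=
  ((gaussianReal 0 (v / 2)).prod (gaussianReal 0 (v / 2))).map
    (fun p : ℝ × ℝ => (⟨p.1, p.2⟩ : ℂ))

/-- `CN(0, I_N)` on `ℂ^N`: independent `CN(0, 1)` coordinates. -/
def complexGaussianVec (N : ℕ) : Measure (EuclideanSpace ℂ (Fin N)) :=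
  (Measure.pi (fun _ : Fin N => complexGaussian 1)).map (WithLp.toLp 2)

/-- The joint law of `(x, y)`, where `y = (F + s G) x + z` with `x ∼ μ`, `s ∼ CN(0, σ²)` and
`z ∼ CN(0, I_N)` independent. -/
def jointLaw {N : ℕ} (F G : Matrix (Fin N) (Fin N) ℂ) (σ : ℝ)
    (μ : Measure (EuclideanSpace ℂ (Fin N))) :
    Measure (EuclideanSpace ℂ (Fin N) × EuclideanSpace ℂ (Fin N)) :=
  (μ.prod ((complexGaussian (Real.toNNReal (σ ^ 2))).prod (complexGaussianVec N))).map
    (fun p => (p.1, Matrix.toEuclideanLin (F + p.2.1 • G) p.1 + p.2.2))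

/-- The mutual information (in nats) of a pair with joint law `ρ`: the Kullback-Leibler
divergence of `ρ` from the product of its marginals. -/
def mutualInfo {X Y : Type*} [MeasurableSpace X] [MeasurableSpace Y] (ρ : Measure (X × Y)) :
    ℝ≥0∞ :=
  InformationTheory.klDiv ρ (ρ.fst.prod ρ.snd)

/-- The input laws with average power `E ‖x‖² ≤ P`. -/
def inputLaws (N : ℕ) (P : ℝ) : Set (Measure (EuclideanSpace ℂ (Fin N))) :=
  {μ | IsProbabilityMeasure μ ∧ ∫⁻ x, ‖x‖ₑ ^ 2 ∂μ ≤ ENNReal.ofReal P}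

/-- The capacity `C(P)`: the supremum of `I(x; y)` over the input laws with `E ‖x‖² ≤ P`. -/
def capacity {N : ℕ} (F G : Matrix (Fin N) (Fin N) ℂ) (σ P : ℝ) : ℝ≥0∞ :=
  ⨆ μ ∈ inputLaws N P, mutualInfo (jointLaw F G σ μ)

/-- The capacity `C(P, r)`: the inputs are moreover supported in the ball `‖x‖ ≤ r`. -/
def capacityBall {N : ℕ} (F G : Matrix (Fin N) (Fin N) ℂ) (σ P r : ℝ) : ℝ≥0∞ :=
  ⨆ μ ∈ {μ | μ ∈ inputLaws N P ∧ ∀ᵐ x ∂μ, ‖x‖ ≤ r}, mutualInfo (jointLaw F G σ μ)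

/-- The matrices `Q ⪰ 0` with `tr Q ≤ P`. -/
def covariances (N : ℕ) (P : ℝ) : Set (Matrix (Fin N) (Fin N) ℂ) :=
  {Q | Q.PosSemidef ∧ Q.trace.re ≤ P}

/-- `Σ_y = I + F Q F^H + σ² G Q G^H`. -/
def outputCov {N : ℕ} (F G : Matrix (Fin N) (Fin N) ℂ) (σ : ℝ) (Q : Matrix (Fin N) (Fin N) ℂ) :
    Matrix (Fin N) (Fin N) ℂ :=
  1 + F * Q * Fᴴ + ((σ ^ 2 : ℝ) : ℂ) • (G * Q * Gᴴ)

/-- `β = (1 / α) tr (S Σ_y)`. -/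
def beta {N : ℕ} (F G : Matrix (Fin N) (Fin N) ℂ) (σ α : ℝ) (Q S : Matrix (Fin N) (Fin N) ℂ) : ℝ :=
  1 / α * (S * outputCov F G σ Q).trace.re

/-- `γ(S, x) = tr S + x^H (F^H S F + σ² G^H S G) x`. -/
def gam {N : ℕ} (F G : Matrix (Fin N) (Fin N) ℂ) (σ : ℝ) (S : Matrix (Fin N) (Fin N) ℂ)
    (x : EuclideanSpace ℂ (Fin N)) : ℝ :=
  S.trace.re +
    (star x.ofLp ⬝ᵥ ((Fᴴ * S * F + ((σ ^ 2 : ℝ) : ℂ) • (Gᴴ * S * G)) *ᵥ x.ofLp)).re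

/-- The bound `R_UB(α, S, Q)` (for the radius `r`). The supremum is over a compact ball, on which
the function is continuous when `S ≻ 0`. -/
def rateUB {N : ℕ} (F G : Matrix (Fin N) (Fin N) ℂ) (σ r α : ℝ)
    (S Q : Matrix (Fin N) (Fin N) ℂ) : ℝ :=
  α * Real.log (beta F G σ α Q S) + Real.log (Real.Gamma α / Real.Gamma N) + α - N
    - Real.log S.det.re
    + ⨆ x : Metric.closedBall (0 : EuclideanSpace ℂ (Fin N)) r,
        Real.log (gam F G σ S x ^ ((N : ℝ) - α) /
          (1 + σ ^ 2 * ‖Matrix.toEuclideanLin G (x : EuclideanSpace ℂ (Fin N))‖ ^ 2))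

/-- The infimum of `R_UB(α, S, Q)` over `0 < α ≤ N` and `S ≻ 0`, as an extended real. -/
def infRateUB {N : ℕ} (F G : Matrix (Fin N) (Fin N) ℂ) (σ r : ℝ)
    (Q : Matrix (Fin N) (Fin N) ℂ) : EReal :=
  ⨅ α ∈ Set.Ioc (0 : ℝ) N, ⨅ S ∈ {S : Matrix (Fin N) (Fin N) ℂ | S.PosDef},
    ((rateUB F G σ r α S Q : ℝ) : EReal)

/-- `log det Σ_y`. -/
def logDetUB {N : ℕ} (F G : Matrix (Fin N) (Fin N) ℂ) (σ : ℝ)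
    (Q : Matrix (Fin N) (Fin N) ℂ) : ℝ :=
  Real.log (outputCov F G σ Q).det.re

/-- The choice `S = det(Σ_y)^{1/N} Σ_y⁻¹`. -/
def whiteningS {N : ℕ} (F G : Matrix (Fin N) (Fin N) ℂ) (σ : ℝ)
    (Q : Matrix (Fin N) (Fin N) ℂ) : Matrix (Fin N) (Fin N) ℂ :=
  (((outputCov F G σ Q).det.re ^ (1 / (N : ℝ)) : ℝ) : ℂ) • (outputCov F G σ Q)⁻¹

end

end DopplerChannel

namespace DopplerChannel

/-! The argument is the duality bound: for every output density `q`, `I(x; y)` is at most the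
average over `x` of the divergence of the channel law `W(·|x)` from `q`, because the true output
density minimizes that average (`mutualInfo_withDensity_le`).

Given `x`, the output is Gaussian with mean `Fx` and covariance `I + σ² (Gx)(Gx)^H`, so its entropy
is explicit and contributes `-log (1 + σ² ‖Gx‖²) - N` up to a power of `π`. The reference `q` is
proportional to `(y^H S y)^(α - N) exp (-y^H S y / β)`, which makes `y^H S y` Gamma distributed with
shape `α` and scale `β`. The cross term then involves only the conditional means of `y^H S y`, which
is `γ(S, x)`, and of `log (y^H S y)`, which concavity bounds by `log γ(S, x)` since `α ≤ N`
(`lintegral_klFun_refDensity_le`).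

Averaging over `x` with `Q = E[x x^H]` gives `E γ(S, x) = tr (S Σ_y(Q)) = α β`. Hence the term `γ /
β` averages to `α`, and what still depends on `x` is bounded by its supremum. This is `R_UB(α, S,
Q)` (`mutualInfo_jointLaw_le`). The parameters are free, so the infimum at this `Q` bounds the
mutual information, and `Q` is admissible. The maximum over `Q` is attained because an infimum of
continuous functions is upper semicontinuous and the admissible `Q` form a compact set.

For `α = N` the power of `γ` disappears, the term in `x` is at most `0` for every `x`, and no
support constraint is needed. With the whitening `S` the reference is the Gaussian of covariance
`Σ_y`, and the bound becomes `log det Σ_y`. -/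

/-! ### Duality bound for mutual information -/

open InformationTheory in
/-- The mean minimizes the expected `klFun` perspective among all reference values. -/
lemma lintegral_perspective_klFun_mean_le {X : Type*} [MeasurableSpace X] (μ : Measure X)
    [IsProbabilityMeasure μ] {f : X → ℝ} (hf : Measurable f) (hf0 : ∀ x, 0 < f x) {C : ℝ}
    (hfC : ∀ x, f x ≤ C) {q : ℝ} (hq : 0 < q) (hp : 0 < ∫ x, f x ∂μ) :
    ∫⁻ x, ENNReal.ofReal ((∫ x, f x ∂μ) * klFun (f x / ∫ x, f x ∂μ)) ∂μ
      ≤ ∫⁻ x, ENNReal.ofReal (q * klFun (f x / q)) ∂μ := by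
  have hint : ∀ c : ℝ, 0 < c → Integrable (fun x => c * klFun (f x / c)) μ := by
    intro c hc
    obtain ⟨B, hB⟩ := (isCompact_Icc (a := (0 : ℝ)) (b := C / c)).exists_bound_of_continuousOn
      continuous_klFun.continuousOn
    refine (Integrable.of_bound (C := B) ?_ ?_).const_mul c
    · exact (measurable_klFun.comp (hf.div_const c)).aestronglyMeasurable
    · exact Filter.Eventually.of_forall fun x => hB _
        ⟨(div_pos (hf0 x) hc).le, div_le_div_of_nonneg_right (hfC x) hc.le⟩
  have hfi : Integrable f μ := Integrable.of_bound (C := C) hf.aestronglyMeasurable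
    (Filter.Eventually.of_forall fun x => by
      rw [Real.norm_eq_abs, abs_of_pos (hf0 x)]; exact hfC x)
  set p := ∫ x, f x ∂μ with hpdef
  have hnn : ∀ c : ℝ, 0 < c → ∀ x, 0 ≤ c * klFun (f x / c) := fun c hc x =>
    mul_nonneg hc.le (klFun_nonneg (div_pos (hf0 x) hc).le)
  rw [← ofReal_integral_eq_lintegral_ofReal (hint p hp) (Filter.Eventually.of_forall (hnn p hp)),
    ← ofReal_integral_eq_lintegral_ofReal (hint q hq) (Filter.Eventually.of_forall (hnn q hq))]
  refine ENNReal.ofReal_le_ofReal ?_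
  -- Replacing the reference `p` by `q` adds a term affine in `f`. As `f` has mean `p`, that term
  -- has mean `p log (p / q) + q - p = q * klFun (p / q) ≥ 0`.
  have hpt : ∀ x, q * klFun (f x / q) =
      p * klFun (f x / p) + (f x * Real.log (p / q) + (q - p)) := by
    intro x
    simp only [klFun_apply]
    rw [Real.log_div (hf0 x).ne' hq.ne', Real.log_div (hf0 x).ne' hp.ne',
      Real.log_div hp.ne' hq.ne']
    field_simp
    ring
  have hmean : 0 ≤ p * Real.log (p / q) + (q - p) := by
    have := mul_nonneg hq.le (klFun_nonneg (div_pos hp hq).le)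
    rw [klFun_apply] at this
    have e : q * (p / q * Real.log (p / q) + 1 - p / q) = p * Real.log (p / q) + (q - p) := by
      field_simp
      ring
    rwa [e] at this
  have hI : Integrable (fun x => f x * Real.log (p / q) + (q - p)) μ :=
    (hfi.mul_const _).add (integrable_const _)
  have hadd : ∫ x, (f x * Real.log (p / q) + (q - p)) ∂μ = p * Real.log (p / q) + (q - p) := by
    rw [integral_add (hfi.mul_const _) (integrable_const _), integral_mul_const, integral_const]
    simp [hpdef]
  simp_rw [hpt]
  rw [integral_add (hint p hp) hI, hadd]
  linarith

open InformationTheory in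
/-- Duality bound: the mutual information is at most the average divergence of the channel law
from any reference density `q`. -/
lemma mutualInfo_withDensity_le {X Y : Type*} [MeasurableSpace X] [MeasurableSpace Y]
    (μ : Measure X) [IsProbabilityMeasure μ] (ν : Measure Y) [SigmaFinite ν]
    {w : X → Y → ℝ} (hw : Measurable (Function.uncurry w)) (hw0 : ∀ x y, 0 < w x y) {C : ℝ}
    (hwC : ∀ x y, w x y ≤ C) (hw1 : ∀ x, ∫⁻ y, ENNReal.ofReal (w x y) ∂ν = 1)
    {q : Y → ℝ} (hq : Measurable q) (hq0 : ∀ y, 0 < q y) :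
    mutualInfo ((μ.prod ν).withDensity fun z => ENNReal.ofReal (w z.1 z.2))
      ≤ ∫⁻ x, ∫⁻ y, ENNReal.ofReal (q y * klFun (w x y / q y)) ∂ν ∂μ := by
  have hw' : Measurable fun z : X × Y => w z.1 z.2 := hw
  have hW : Measurable fun z : X × Y => ENNReal.ofReal (w z.1 z.2) := hw'.ennreal_ofReal
  have hwx : ∀ y, Measurable fun x => w x y := fun y => hw'.comp measurable_prodMk_right
  have hwi : ∀ y, Integrable (fun x => w x y) μ := fun y =>
    Integrable.of_bound (C := C) (hwx y).aestronglyMeasurable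
    (Filter.Eventually.of_forall fun x => by
      rw [Real.norm_eq_abs, abs_of_pos (hw0 x y)]; exact hwC x y)
  set p : Y → ℝ := fun y => ∫ x, w x y ∂μ with hpdef
  have hp0 : ∀ y, 0 < p y := fun y => by
    refine (integral_pos_iff_support_of_nonneg (fun x => (hw0 x y).le) (hwi y)).2 ?_
    have : Function.support (fun x => w x y) = Set.univ := by
      ext x; simp [(hw0 x y).ne']
    rw [this, measure_univ]; exact zero_lt_one
  have hpm : Measurable p :=
    (StronglyMeasurable.integral_prod_left' (μ := μ) hw'.stronglyMeasurable).measurable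
  have hpE : ∀ y, ENNReal.ofReal (p y) = ∫⁻ x, ENNReal.ofReal (w x y) ∂μ := fun y =>
    ofReal_integral_eq_lintegral_ofReal (hwi y)
      (Filter.Eventually.of_forall fun x => (hw0 x y).le)
  set ρ := (μ.prod ν).withDensity fun z => ENNReal.ofReal (w z.1 z.2) with hρ
  have hfst : ρ.fst = μ := by
    ext s hs
    rw [Measure.fst_apply hs, hρ, withDensity_apply _ (measurable_fst hs),
      ← Set.prod_univ, ← Measure.prod_restrict, lintegral_prod _ hW.aemeasurable]
    simp [hw1]
  have hsnd : ρ.snd = ν.withDensity fun y => ENNReal.ofReal (p y) := by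
    ext s hs
    rw [Measure.snd_apply hs, hρ, withDensity_apply _ (measurable_snd hs),
      withDensity_apply _ hs, ← Set.univ_prod, ← Measure.prod_restrict,
      lintegral_prod_symm _ hW.aemeasurable]
    simp [hpE]
  have hprob : IsProbabilityMeasure ρ := ⟨by
    rw [← Measure.fst_univ, hfst, measure_univ]⟩
  set τ := ρ.fst.prod ρ.snd with hτ
  have hτ' : τ = (μ.prod ν).withDensity fun z => ENNReal.ofReal (p z.2) := by
    rw [hτ, hfst, hsnd, prod_withDensity_right hpm.ennreal_ofReal]
  have hp2 : Measurable fun z : X × Y => p z.2 := hpm.comp measurable_snd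
  have hdm : Measurable fun z : X × Y => ENNReal.ofReal (w z.1 z.2 / p z.2) :=
    (hw'.div hp2).ennreal_ofReal
  have hρτ : ρ = τ.withDensity fun z => ENNReal.ofReal (w z.1 z.2 / p z.2) := by
    rw [hτ', ← withDensity_mul _ hp2.ennreal_ofReal hdm, hρ]
    congr 1
    ext z
    rw [Pi.mul_apply, ← ENNReal.ofReal_mul (hp0 _).le, mul_div_cancel₀ _ (hp0 _).ne']
  have hac : ρ ≪ τ := by
    rw [hρτ]; exact withDensity_absolutelyContinuous _ _
  have hrn : ρ.rnDeriv τ =ᵐ[τ] fun z => ENNReal.ofReal (w z.1 z.2 / p z.2) := by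
    conv_lhs => rw [hρτ]
    exact Measure.rnDeriv_withDensity τ hdm
  have hkm : ∀ {g : Y → ℝ}, Measurable g →
      Measurable fun z : X × Y => ENNReal.ofReal (g z.2 * klFun (w z.1 z.2 / g z.2)) := by
    intro g hg
    have hg2 : Measurable fun z : X × Y => g z.2 := hg.comp measurable_snd
    exact (hg2.mul (measurable_klFun.comp (hw'.div hg2))).ennreal_ofReal
  have hkw : Measurable fun z : X × Y => ENNReal.ofReal (klFun (w z.1 z.2 / p z.2)) :=
    (measurable_klFun.comp (hw'.div hp2)).ennreal_ofReal
  have hkl : mutualInfo ρ =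
      ∫⁻ z, ENNReal.ofReal (p z.2 * klFun (w z.1 z.2 / p z.2)) ∂(μ.prod ν) := by
    rw [mutualInfo, klDiv_eq_lintegral_klFun_of_ac hac]
    have : ∫⁻ z, ENNReal.ofReal (klFun (ρ.rnDeriv τ z).toReal) ∂τ
        = ∫⁻ z, ENNReal.ofReal (klFun (w z.1 z.2 / p z.2)) ∂τ := by
      refine lintegral_congr_ae ?_
      filter_upwards [hrn] with z hz
      rw [hz, ENNReal.toReal_ofReal (div_pos (hw0 _ _) (hp0 _)).le]
    rw [this, hτ', lintegral_withDensity_eq_lintegral_mul _ hp2.ennreal_ofReal hkw]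
    refine lintegral_congr fun z => ?_
    rw [Pi.mul_apply, ← ENNReal.ofReal_mul (hp0 _).le]
  rw [hkl, lintegral_prod_symm _ (hkm hpm).aemeasurable]
  -- The comparison is made for each fixed `y`. The perspective of `klFun` is nonnegative, so
  -- Tonelli applies without integrability of any logarithm.
  calc _ ≤ ∫⁻ y, ∫⁻ x, ENNReal.ofReal (q y * klFun (w x y / q y)) ∂μ ∂ν :=
        lintegral_mono fun y =>
          lintegral_perspective_klFun_mean_le μ (hwx y) (fun x => hw0 x y) (fun x => hwC x y)
            (hq0 y) (hp0 y)
    _ = _ := by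
        rw [← lintegral_prod_symm _ (hkm hq).aemeasurable, lintegral_prod _ (hkm hq).aemeasurable]

/-! ### Gaussian integrals -/

/-- Completing the square: the tilted density is a constant times the Gaussian density of variance
`v / (1 + 2 k v)` and mean `b` times that variance. -/
lemma lintegral_exp_quadratic_gaussianReal (v : ℝ≥0) {k : ℝ} (hk : 0 ≤ k) (b : ℝ) :
    ∫⁻ t, ENNReal.ofReal (Real.exp (-(k * t ^ 2) + b * t)) ∂(gaussianReal 0 v)
      = ENNReal.ofReal ((√(1 + 2 * k * v))⁻¹ *
          Real.exp (b ^ 2 * v / (2 * (1 + 2 * k * v)))) := by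
  -- The degenerate case occurs for `σ = 0`, where the law is a Dirac mass without density.
  by_cases hv : v = 0
  · subst hv
    rw [gaussianReal_zero_var, lintegral_dirac]
    simp
  have hv' : (0 : ℝ) < v := by positivity
  have hd : 0 < 1 + 2 * k * v := by positivity
  set v' : ℝ≥0 := ⟨v / (1 + 2 * k * v), by positivity⟩ with hv'def
  have hv'c : (v' : ℝ) = v / (1 + 2 * k * v) := rfl
  have hv'0 : v' ≠ 0 := by
    intro h
    have : (v' : ℝ) = 0 := by rw [h]; rfl
    rw [hv'c] at this
    exact (div_pos hv' hd).ne' this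
  rw [gaussianReal_of_var_ne_zero _ hv,
    lintegral_withDensity_eq_lintegral_mul _ (measurable_gaussianPDF _ _) (by fun_prop)]
  have key : ∀ t, (gaussianPDF 0 v * fun t => ENNReal.ofReal (Real.exp (-(k * t ^ 2) + b * t))) t
      = ENNReal.ofReal ((√(1 + 2 * k * v))⁻¹ * Real.exp (b ^ 2 * v / (2 * (1 + 2 * k * v))))
        * gaussianPDF (b * v') v' t := by
    intro t
    rw [Pi.mul_apply, gaussianPDF, gaussianPDF, ← ENNReal.ofReal_mul (gaussianPDFReal_nonneg _ _ _),
      ← ENNReal.ofReal_mul (by positivity), gaussianPDFReal, gaussianPDFReal, hv'c]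
    congr 1
    have hs : √(2 * Real.pi * (v / (1 + 2 * k * v))) * √(1 + 2 * k * v)
        = √(2 * Real.pi * v) := by
      rw [← Real.sqrt_mul (by positivity)]
      congr 1
      field_simp
    rw [mul_assoc, ← Real.exp_add, ← hs, mul_inv]
    have he : -(t - 0) ^ 2 / (2 * (v : ℝ)) + (-(k * t ^ 2) + b * t)
        = b ^ 2 * v / (2 * (1 + 2 * k * v))
          + -(t - b * (v / (1 + 2 * k * v))) ^ 2 / (2 * (v / (1 + 2 * k * v))) := by
      field_simp
      ring
    rw [he, Real.exp_add]
    ring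
  rw [lintegral_congr key, lintegral_const_mul _ (measurable_gaussianPDF _ _),
    lintegral_gaussianPDF_eq_one _ hv'0, mul_one]

lemma measurable_complex_mk : Measurable fun p : ℝ × ℝ => (⟨p.1, p.2⟩ : ℂ) :=
  Complex.measurableEquivRealProd.symm.measurable

instance instIsProbabilityMeasure_complexGaussian (v : ℝ≥0) :
    IsProbabilityMeasure (complexGaussian v) :=
  Measure.isProbabilityMeasure_map measurable_complex_mk.aemeasurable

instance instIsProbabilityMeasure_complexGaussianVec (N : ℕ) :
    IsProbabilityMeasure (complexGaussianVec N) :=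
  Measure.isProbabilityMeasure_map (WithLp.measurable_toLp 2 _).aemeasurable

lemma lintegral_complexGaussian (v : ℝ≥0) {f : ℂ → ℝ≥0∞} (hf : Measurable f) :
    ∫⁻ s, f s ∂(complexGaussian v)
      = ∫⁻ a, ∫⁻ b, f ⟨a, b⟩ ∂(gaussianReal 0 (v / 2)) ∂(gaussianReal 0 (v / 2)) := by
  have hc : Measurable fun p : ℝ × ℝ => f ⟨p.1, p.2⟩ := hf.comp measurable_complex_mk
  rw [complexGaussian, lintegral_map hf measurable_complex_mk, lintegral_prod _ hc.aemeasurable]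

/-- Gaussian integral of the exponential of `-k |s|² + 2 Re (conj c * s)`. -/
lemma lintegral_exp_quadratic_complexGaussian (v : ℝ≥0) {k : ℝ} (hk : 0 ≤ k) (c : ℂ) :
    ∫⁻ s : ℂ, ENNReal.ofReal (Real.exp (-(k * ‖s‖ ^ 2) + 2 * (starRingEnd ℂ c * s).re))
        ∂(complexGaussian v)
      = ENNReal.ofReal ((1 + k * v)⁻¹ * Real.exp (‖c‖ ^ 2 * v / (1 + k * v))) := by
  rw [lintegral_complexGaussian _ (by fun_prop)]
  have hsplit : ∀ a b : ℝ,
      ENNReal.ofReal (Real.exp (-(k * ‖(⟨a, b⟩ : ℂ)‖ ^ 2)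
        + 2 * (starRingEnd ℂ c * (⟨a, b⟩ : ℂ)).re))
      = ENNReal.ofReal (Real.exp (-(k * a ^ 2) + 2 * c.re * a))
        * ENNReal.ofReal (Real.exp (-(k * b ^ 2) + 2 * c.im * b)) := by
    intro a b
    rw [← ENNReal.ofReal_mul (Real.exp_pos _).le, ← Real.exp_add]
    congr 2
    rw [← Complex.normSq_eq_norm_sq, Complex.normSq_mk]
    simp only [Complex.mul_re, Complex.conj_re, Complex.conj_im]
    ring
  simp_rw [hsplit]
  have hm : ∀ b' : ℝ, Measurable fun b : ℝ =>
      ENNReal.ofReal (Real.exp (-(k * b ^ 2) + b' * b)) := fun b' => by fun_prop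
  simp_rw [lintegral_const_mul _ (hm _)]
  rw [lintegral_mul_const _ (hm _), lintegral_exp_quadratic_gaussianReal _ hk,
    lintegral_exp_quadratic_gaussianReal _ hk, ← ENNReal.ofReal_mul (by positivity)]
  congr 1
  have hv2 : ((v / 2 : ℝ≥0) : ℝ) = v / 2 := by push_cast; rfl
  rw [hv2]
  have h1 : 1 + 2 * k * ((v : ℝ) / 2) = 1 + k * v := by ring
  have hd : 0 < 1 + k * (v : ℝ) := by positivity
  rw [h1, mul_mul_mul_comm, ← mul_inv, Real.mul_self_sqrt hd.le, ← Real.exp_add,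
    ← Complex.normSq_eq_norm_sq, Complex.normSq_apply]
  congr 2
  field_simp

/-! ### Lebesgue measure on `ℂ^N` and the noise density -/

/-- Lebesgue measure on `ℂ^N`. -/
noncomputable def lebesgueVec (N : ℕ) : Measure (EuclideanSpace ℂ (Fin N)) :=
  (volume : Measure (Fin N → ℂ)).map (WithLp.toLp 2)

/-- Seen as the image under a real continuous linear equivalence, the measure is additive Haar. This
provides translation invariance, polar coordinates and the linear change of variables. -/
lemma lebesgueVec_eq_map (N : ℕ) : lebesgueVec N =
    (volume : Measure (Fin N → ℂ)).map
      ((PiLp.continuousLinearEquiv 2 ℝ (fun _ : Fin N => ℂ)).symm) := rfl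

instance instIsAddHaarMeasure_lebesgueVec (N : ℕ) : (lebesgueVec N).IsAddHaarMeasure := by
  rw [lebesgueVec_eq_map]
  exact ContinuousLinearEquiv.isAddHaarMeasure_map _ _

lemma complexGaussian_one :
    complexGaussian 1 =
      volume.withDensity fun z : ℂ => ENNReal.ofReal (Real.pi⁻¹ * Real.exp (-‖z‖ ^ 2)) := by
  have h2 : (1 / 2 : ℝ≥0) ≠ 0 := by positivity
  refine Measure.ext_of_lintegral _ fun f hf => ?_
  have hm : Measurable fun z : ℂ => ENNReal.ofReal (Real.pi⁻¹ * Real.exp (-‖z‖ ^ 2)) := by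
    fun_prop
  have hc : Measurable fun p : ℝ × ℝ => f ⟨p.1, p.2⟩ := hf.comp measurable_complex_mk
  have hgg : Measurable fun p : ℝ × ℝ => gaussianPDF 0 (1 / 2) p.1 * gaussianPDF 0 (1 / 2) p.2 :=
    ((measurable_gaussianPDF _ _).comp measurable_fst).mul
      ((measurable_gaussianPDF _ _).comp measurable_snd)
  rw [lintegral_withDensity_eq_lintegral_mul _ hm hf,
    ← Complex.volume_preserving_equiv_real_prod.symm.lintegral_comp (hm.mul hf),
    complexGaussian, lintegral_map hf measurable_complex_mk, gaussianReal_of_var_ne_zero _ h2,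
    prod_withDensity (measurable_gaussianPDF _ _) (measurable_gaussianPDF _ _),
    lintegral_withDensity_eq_lintegral_mul _ hgg hc]
  refine lintegral_congr fun p => ?_
  simp only [Pi.mul_apply]
  congr 1
  rw [gaussianPDF, gaussianPDF, ← ENNReal.ofReal_mul (gaussianPDFReal_nonneg _ _ _)]
  congr 1
  change _ = Real.pi⁻¹ * Real.exp (-‖(⟨p.1, p.2⟩ : ℂ)‖ ^ 2)
  rw [← Complex.normSq_eq_norm_sq, Complex.normSq_mk, gaussianPDFReal, gaussianPDFReal,
    mul_mul_mul_comm, ← mul_inv, Real.mul_self_sqrt (by positivity), ← Real.exp_add]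
  push_cast
  congr 2
  · ring
  · ring

/-- The standard Gaussian density on `ℂ^N`. -/
noncomputable def gaussDensity (N : ℕ) (y : EuclideanSpace ℂ (Fin N)) : ℝ :=
  (Real.pi ^ N)⁻¹ * Real.exp (-‖y‖ ^ 2)

lemma continuous_gaussDensity (N : ℕ) : Continuous (gaussDensity N) := by
  unfold gaussDensity; fun_prop

lemma complexGaussianVec_eq_withDensity (N : ℕ) :
    complexGaussianVec N =
      (lebesgueVec N).withDensity fun y => ENNReal.ofReal (gaussDensity N y) := by
  set g : ℂ → ℝ := fun z => Real.pi⁻¹ * Real.exp (-‖z‖ ^ 2) with hg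
  have hgm : Measurable g := by simp only [hg]; fun_prop
  have hg0 : ∀ z, 0 ≤ g z := fun z => by simp only [hg]; positivity
  have hgi : Integrable g := by
    refine ⟨hgm.aestronglyMeasurable, ?_⟩
    rw [hasFiniteIntegral_iff_ofReal (Filter.Eventually.of_forall hg0)]
    have := measure_univ (μ := complexGaussian 1)
    rw [complexGaussian_one, withDensity_apply _ MeasurableSet.univ, Measure.restrict_univ] at this
    rw [this]
    exact ENNReal.one_lt_top
  have hpi : Measure.pi (fun _ : Fin N => complexGaussian 1)
      = (volume : Measure (Fin N → ℂ)).withDensity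
          fun x => ENNReal.ofReal (∏ i, g (x i)) := by
    refine (Measure.pi_eq fun s hs => ?_)
    rw [withDensity_apply _ (MeasurableSet.univ_pi hs), volume_pi, Measure.restrict_pi_pi,
      ← ofReal_integral_eq_lintegral_ofReal
        (Integrable.fintype_prod (f := fun _ => g) fun i => hgi.restrict)
        (Filter.Eventually.of_forall fun x => Finset.prod_nonneg fun i _ => hg0 _),
      integral_fintype_prod_eq_prod (fun _ => g),
      ENNReal.ofReal_prod_of_nonneg fun i _ => integral_nonneg hg0]
    refine Finset.prod_congr rfl fun i _ => ?_
    rw [complexGaussian_one, withDensity_apply _ (hs i),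
      ofReal_integral_eq_lintegral_ofReal hgi.restrict (Filter.Eventually.of_forall hg0)]
  have hdm : Measurable fun y => ENNReal.ofReal (gaussDensity N y) :=
    (continuous_gaussDensity N).measurable.ennreal_ofReal
  have hpm : Measurable fun x : Fin N → ℂ => ENNReal.ofReal (∏ i, g (x i)) := by
    fun_prop
  refine Measure.ext_of_lintegral _ fun f hf => ?_
  have ht : Measurable (WithLp.toLp 2 : (Fin N → ℂ) → EuclideanSpace ℂ (Fin N)) :=
    WithLp.measurable_toLp 2 _
  have hc : Measurable fun x : Fin N → ℂ => f (WithLp.toLp 2 x) := hf.comp ht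
  rw [complexGaussianVec, hpi, lintegral_map hf ht,
    lintegral_withDensity_eq_lintegral_mul _ hpm hc,
    lintegral_withDensity_eq_lintegral_mul _ hdm hf, lebesgueVec, lintegral_map (hdm.mul hf) ht]
  refine lintegral_congr fun x => ?_
  simp only [Pi.mul_apply]
  congr 2
  rw [gaussDensity, EuclideanSpace.norm_sq_eq]
  simp only [hg, Finset.prod_mul_distrib, ← Real.exp_sum, Finset.prod_const, Finset.card_univ,
    Fintype.card_fin, Finset.sum_neg_distrib, inv_pow]

/-! ### Density of the channel -/

/-- The density of `s • v + z`, for independent `s ∼ CN(0, σ²)` and `z ∼ CN(0, I_N)`. -/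
noncomputable def mixDensity {N : ℕ} (σ : ℝ) (v y : EuclideanSpace ℂ (Fin N)) : ℝ :=
  (Real.pi ^ N)⁻¹ * ((1 + σ ^ 2 * ‖v‖ ^ 2)⁻¹ *
    Real.exp (-‖y‖ ^ 2 + σ ^ 2 * ‖inner ℂ v y‖ ^ 2 / (1 + σ ^ 2 * ‖v‖ ^ 2)))

variable {N : ℕ}

lemma one_add_sq_mul_norm_sq_pos (σ : ℝ) (v : EuclideanSpace ℂ (Fin N)) :
    0 < 1 + σ ^ 2 * ‖v‖ ^ 2 := by positivity

lemma mixDensity_pos (σ : ℝ) (v y : EuclideanSpace ℂ (Fin N)) : 0 < mixDensity σ v y := by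
  have := one_add_sq_mul_norm_sq_pos σ v
  unfold mixDensity
  positivity

lemma continuous_mixDensity (σ : ℝ) :
    Continuous fun p : EuclideanSpace ℂ (Fin N) × EuclideanSpace ℂ (Fin N) =>
      mixDensity σ p.1 p.2 := by
  have h : ∀ p : EuclideanSpace ℂ (Fin N) × EuclideanSpace ℂ (Fin N),
      1 + σ ^ 2 * ‖p.1‖ ^ 2 ≠ 0 := fun p => (one_add_sq_mul_norm_sq_pos σ p.1).ne'
  unfold mixDensity
  have hc : Continuous fun p : EuclideanSpace ℂ (Fin N) × EuclideanSpace ℂ (Fin N) =>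
      1 + σ ^ 2 * ‖p.1‖ ^ 2 := by fun_prop
  refine continuous_const.mul ((hc.inv₀ h).mul (Real.continuous_exp.comp ?_))
  refine Continuous.add (by fun_prop) (Continuous.div ?_ hc h)
  exact continuous_const.mul ((continuous_fst.inner continuous_snd).norm.pow 2)

/-- Cauchy–Schwarz makes the exponent nonpositive. The uniform bound supplies the constant `C`
required by the duality bound. -/
lemma mixDensity_le (σ : ℝ) (v y : EuclideanSpace ℂ (Fin N)) :
    mixDensity σ v y ≤ (Real.pi ^ N)⁻¹ := by
  have hd := one_add_sq_mul_norm_sq_pos σ v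
  unfold mixDensity
  refine mul_le_of_le_one_right (by positivity) ?_
  refine mul_le_one₀ (inv_le_one_of_one_le₀ (by nlinarith [sq_nonneg (σ * ‖v‖)]))
    (Real.exp_pos _).le (Real.exp_le_one_iff.2 ?_)
  have hcs : ‖inner ℂ v y‖ ^ 2 ≤ (‖v‖ * ‖y‖) ^ 2 :=
    pow_le_pow_left₀ (norm_nonneg _) (norm_inner_le_norm v y) 2
  have : σ ^ 2 * ‖inner ℂ v y‖ ^ 2 / (1 + σ ^ 2 * ‖v‖ ^ 2) ≤ ‖y‖ ^ 2 := by
    rw [div_le_iff₀ hd]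
    nlinarith [mul_le_mul_of_nonneg_left hcs (sq_nonneg σ), sq_nonneg ‖y‖]
  linarith

/-- Given `s`, the output is standard Gaussian around `s • v`. Integrating out `s` is the complex
Gaussian integral with `k = ‖v‖²` and `c = ⟨v, y⟩`. The result is the density of `CN(0, I + σ² v
v^H)`, with determinant and inverse written out by the rank-one update formulas. -/
lemma lintegral_gaussDensity_sub_smul (σ : ℝ) (v y : EuclideanSpace ℂ (Fin N)) :
    ∫⁻ s, ENNReal.ofReal (gaussDensity N (y - s • v)) ∂(complexGaussian (Real.toNNReal (σ ^ 2)))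
      = ENNReal.ofReal (mixDensity σ v y) := by
  have hpt : ∀ s : ℂ, ENNReal.ofReal (gaussDensity N (y - s • v))
      = ENNReal.ofReal ((Real.pi ^ N)⁻¹ * Real.exp (-‖y‖ ^ 2)) * ENNReal.ofReal
        (Real.exp (-(‖v‖ ^ 2 * ‖s‖ ^ 2) + 2 * (starRingEnd ℂ (inner ℂ v y) * s).re)) := by
    intro s
    rw [← ENNReal.ofReal_mul (by positivity), mul_assoc, ← Real.exp_add, gaussDensity,
      @norm_sub_sq ℂ, norm_smul, inner_smul_right, inner_conj_symm, mul_comm s,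
      RCLike.re_eq_complex_re]
    congr 3
    ring
  simp_rw [hpt]
  rw [lintegral_const_mul _ (by fun_prop),
    lintegral_exp_quadratic_complexGaussian _ (sq_nonneg ‖v‖),
    ← ENNReal.ofReal_mul (by positivity), Real.coe_toNNReal _ (sq_nonneg σ), mixDensity,
    mul_assoc, mul_left_comm (Real.exp _), ← Real.exp_add]
  congr 5
  · ring
  · ring

/-- The law of `u + s • v + z`, for independent `s ∼ CN(0, σ²)` and `z ∼ CN(0, I_N)`. -/
noncomputable def mixLaw (σ : ℝ) (u v : EuclideanSpace ℂ (Fin N)) :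
    Measure (EuclideanSpace ℂ (Fin N)) :=
  ((complexGaussian (Real.toNNReal (σ ^ 2))).prod (complexGaussianVec N)).map
    fun p => u + p.1 • v + p.2

lemma measurable_mixLaw_map (u v : EuclideanSpace ℂ (Fin N)) :
    Measurable fun p : ℂ × EuclideanSpace ℂ (Fin N) => u + p.1 • v + p.2 := by fun_prop

instance instIsProbabilityMeasure_mixLaw (σ : ℝ) (u v : EuclideanSpace ℂ (Fin N)) :
    IsProbabilityMeasure (mixLaw σ u v) :=
  Measure.isProbabilityMeasure_map (measurable_mixLaw_map u v).aemeasurable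

lemma measurable_mixDensity_sub (σ : ℝ) (u v : EuclideanSpace ℂ (Fin N)) :
    Measurable fun y => mixDensity σ v (y - u) := by
  have : Continuous fun y : EuclideanSpace ℂ (Fin N) => (v, y - u) := by fun_prop
  exact ((continuous_mixDensity σ).comp this).measurable

lemma mixLaw_eq_withDensity (σ : ℝ) (u v : EuclideanSpace ℂ (Fin N)) :
    mixLaw σ u v =
      (lebesgueVec N).withDensity fun y => ENNReal.ofReal (mixDensity σ v (y - u)) := by
  refine Measure.ext_of_lintegral _ fun f hf => ?_
  have hc : Measurable fun p : ℂ × EuclideanSpace ℂ (Fin N) => f (u + p.1 • v + p.2) :=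
    hf.comp (measurable_mixLaw_map u v)
  have hg : Measurable fun y => ENNReal.ofReal (gaussDensity N y) :=
    (continuous_gaussDensity N).measurable.ennreal_ofReal
  rw [mixLaw, lintegral_map hf (measurable_mixLaw_map u v), lintegral_prod _ hc.aemeasurable,
    lintegral_withDensity_eq_lintegral_mul _ (measurable_mixDensity_sub σ u v).ennreal_ofReal hf]
  have h1 : ∀ s : ℂ, ∫⁻ z, f (u + s • v + z) ∂(complexGaussianVec N)
      = ∫⁻ y, ENNReal.ofReal (gaussDensity N (y - u - s • v)) * f y ∂(lebesgueVec N) := by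
    intro s
    have hfs : Measurable fun z => f (u + s • v + z) := hf.comp (by fun_prop)
    rw [complexGaussianVec_eq_withDensity, lintegral_withDensity_eq_lintegral_mul _ hg hfs,
      ← lintegral_add_left_eq_self
        (fun y => ENNReal.ofReal (gaussDensity N (y - u - s • v)) * f y) (u + s • v)]
    refine lintegral_congr fun z => ?_
    rw [Pi.mul_apply, show u + s • v + z - u - s • v = z by abel]
  have hsw : Measurable fun p : ℂ × EuclideanSpace ℂ (Fin N) =>
      ENNReal.ofReal (gaussDensity N (p.2 - u - p.1 • v)) * f p.2 :=
    (hg.comp (by fun_prop)).mul (hf.comp measurable_snd)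
  simp_rw [h1]
  rw [lintegral_lintegral_swap hsw.aemeasurable]
  refine lintegral_congr fun y => ?_
  have hgy : Measurable fun s : ℂ => ENNReal.ofReal (gaussDensity N (y - u - s • v)) :=
    hg.comp (by fun_prop)
  rw [lintegral_mul_const _ hgy, lintegral_gaussDensity_sub_smul, Pi.mul_apply]

lemma continuous_toEuclideanLin (F : Matrix (Fin N) (Fin N) ℂ) :
    Continuous (Matrix.toEuclideanLin F) :=
  LinearMap.continuous_of_finiteDimensional _

lemma measurable_channelDensity (F G : Matrix (Fin N) (Fin N) ℂ) (σ : ℝ) :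
    Measurable fun p : EuclideanSpace ℂ (Fin N) × EuclideanSpace ℂ (Fin N) =>
      mixDensity σ (Matrix.toEuclideanLin G p.1) (p.2 - Matrix.toEuclideanLin F p.1) := by
  have : Continuous fun p : EuclideanSpace ℂ (Fin N) × EuclideanSpace ℂ (Fin N) =>
      (Matrix.toEuclideanLin G p.1, p.2 - Matrix.toEuclideanLin F p.1) :=
    ((continuous_toEuclideanLin G).comp continuous_fst).prodMk
      (continuous_snd.sub ((continuous_toEuclideanLin F).comp continuous_fst))
  exact ((continuous_mixDensity σ).comp this).measurable

/-- For fixed `x` the output law is `mixLaw` with `u = F x` and `v = G x`; Tonelli assembles these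
fibres. -/
lemma jointLaw_eq_withDensity (F G : Matrix (Fin N) (Fin N) ℂ) (σ : ℝ)
    (μ : Measure (EuclideanSpace ℂ (Fin N))) [IsProbabilityMeasure μ] :
    jointLaw F G σ μ = (μ.prod (lebesgueVec N)).withDensity fun p => ENNReal.ofReal
      (mixDensity σ (Matrix.toEuclideanLin G p.1) (p.2 - Matrix.toEuclideanLin F p.1)) := by
  have hmap : ∀ p : EuclideanSpace ℂ (Fin N) × ℂ × EuclideanSpace ℂ (Fin N),
      Matrix.toEuclideanLin (F + p.2.1 • G) p.1 + p.2.2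
        = Matrix.toEuclideanLin F p.1 + p.2.1 • Matrix.toEuclideanLin G p.1 + p.2.2 := by
    intro p
    rw [map_add, map_smul, LinearMap.add_apply, LinearMap.smul_apply]
  have hT : Measurable fun p : EuclideanSpace ℂ (Fin N) × ℂ × EuclideanSpace ℂ (Fin N) =>
      (p.1, Matrix.toEuclideanLin (F + p.2.1 • G) p.1 + p.2.2) := by
    have e : (fun p : EuclideanSpace ℂ (Fin N) × ℂ × EuclideanSpace ℂ (Fin N) =>
        (p.1, Matrix.toEuclideanLin (F + p.2.1 • G) p.1 + p.2.2)) = fun p =>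
        (p.1, Matrix.toEuclideanLin F p.1 + p.2.1 • Matrix.toEuclideanLin G p.1 + p.2.2) :=
      funext fun p => congrArg (Prod.mk p.1) (hmap p)
    rw [e]
    have hF := (continuous_toEuclideanLin F).measurable
    have hG := (continuous_toEuclideanLin G).measurable
    fun_prop
  have hden := (measurable_channelDensity F G σ).ennreal_ofReal
  refine Measure.ext_of_lintegral _ fun f hf => ?_
  have hfT : Measurable fun p : EuclideanSpace ℂ (Fin N) × ℂ × EuclideanSpace ℂ (Fin N) =>
      f (p.1, Matrix.toEuclideanLin (F + p.2.1 • G) p.1 + p.2.2) := hf.comp hT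
  rw [jointLaw, lintegral_map hf hT, lintegral_prod _ hfT.aemeasurable,
    lintegral_withDensity_eq_lintegral_mul _ hden hf, lintegral_prod _ (hden.mul hf).aemeasurable]
  refine lintegral_congr fun x => ?_
  have hfx : Measurable fun y => f (x, y) := hf.comp measurable_prodMk_left
  have e : ∀ p : ℂ × EuclideanSpace ℂ (Fin N),
      f (x, Matrix.toEuclideanLin (F + p.1 • G) x + p.2)
        = f (x, Matrix.toEuclideanLin F x + p.1 • Matrix.toEuclideanLin G x + p.2) :=
    fun p => congrArg (fun y => f (x, y)) (hmap (x, p))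
  rw [lintegral_congr e]
  rw [← lintegral_map (f := fun y => f (x, y)) hfx (measurable_mixLaw_map _ _)]
  change ∫⁻ y, f (x, y) ∂(mixLaw σ (Matrix.toEuclideanLin F x) (Matrix.toEuclideanLin G x)) = _
  rw [mixLaw_eq_withDensity, lintegral_withDensity_eq_lintegral_mul _
    (measurable_mixDensity_sub σ _ _).ennreal_ofReal hfx]
  rfl

/-! ### Second moments of the output given the input -/

lemma memLp_id_complexGaussian (v : ℝ≥0) : MemLp id 2 (complexGaussian v) := by
  have h := memLp_id_gaussianReal' (μ := 0) (v := v / 2) 2 (by simp)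
  have hf : MemLp (fun p : ℝ × ℝ => (p.1 : ℂ)) 2
      ((gaussianReal 0 (v / 2)).prod (gaussianReal 0 (v / 2))) :=
    (h.comp_measurePreserving measurePreserving_fst).ofReal
  have hs : MemLp (fun p : ℝ × ℝ => (p.2 : ℂ)) 2
      ((gaussianReal 0 (v / 2)).prod (gaussianReal 0 (v / 2))) :=
    (h.comp_measurePreserving measurePreserving_snd).ofReal
  rw [complexGaussian, memLp_map_measure_iff aestronglyMeasurable_id
    measurable_complex_mk.aemeasurable]
  convert hf.add (hs.mul_const Complex.I) using 1
  ext p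
  simp [Complex.mk_eq_add_mul_I]

lemma integral_id_complexGaussian (v : ℝ≥0) : ∫ z, z ∂(complexGaussian v) = 0 := by
  have hi : Integrable (fun z : ℂ => z) (complexGaussian v) :=
    (memLp_id_complexGaussian v).integrable (by norm_num)
  have hg : ∫ t, t ∂(gaussianReal 0 (v / 2)) = 0 := integral_id_gaussianReal
  apply Complex.ext
  · change RCLike.re (K := ℂ) (∫ z, z ∂(complexGaussian v)) = 0
    rw [← integral_re hi, complexGaussian, integral_map measurable_complex_mk.aemeasurable
      (by fun_prop)]
    change ∫ p : ℝ × ℝ, p.1 ∂_ = 0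
    rw [integral_fun_fst (fun t : ℝ => t), hg]
    simp
  · change RCLike.im (K := ℂ) (∫ z, z ∂(complexGaussian v)) = 0
    rw [← integral_im hi, complexGaussian, integral_map measurable_complex_mk.aemeasurable
      (by fun_prop)]
    change ∫ p : ℝ × ℝ, p.2 ∂_ = 0
    rw [integral_fun_snd (fun t : ℝ => t), hg]
    simp

lemma integral_sq_gaussianReal (v : ℝ≥0) : ∫ t, t ^ 2 ∂(gaussianReal 0 v) = v := by
  have h := variance_id_gaussianReal (μ := 0) (v := v)
  rw [variance_of_integral_eq_zero aemeasurable_id (by simp)] at h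
  simpa using h

lemma integral_conj_mul_complexGaussian (v : ℝ≥0) :
    ∫ z, starRingEnd ℂ z * z ∂(complexGaussian v) = v := by
  have h2 : Integrable (fun t : ℝ => t ^ 2) (gaussianReal 0 (v / 2)) :=
    (memLp_id_gaussianReal' (μ := 0) (v := v / 2) 2 (by simp)).integrable_sq
  have hpt : ∀ z : ℂ, starRingEnd ℂ z * z = ((z.re ^ 2 + z.im ^ 2 : ℝ) : ℂ) := by
    intro z
    rw [← Complex.normSq_eq_conj_mul_self, Complex.normSq_apply]
    congr 1
    ring
  simp_rw [hpt]
  rw [integral_complex_ofReal, complexGaussian, integral_map measurable_complex_mk.aemeasurable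
    (by fun_prop)]
  change ((∫ p : ℝ × ℝ, p.1 ^ 2 + p.2 ^ 2 ∂_ : ℝ) : ℂ) = _
  rw [integral_add (h2.comp_fst _) (h2.comp_snd _), integral_fun_fst (fun t : ℝ => t ^ 2),
    integral_fun_snd (fun t : ℝ => t ^ 2), integral_sq_gaussianReal]
  simp

lemma measurePreserving_apply_complexGaussianVec (i : Fin N) :
    MeasurePreserving (fun z : EuclideanSpace ℂ (Fin N) => z i) (complexGaussianVec N)
      (complexGaussian 1) := by
  refine ⟨by fun_prop, ?_⟩
  rw [complexGaussianVec, Measure.map_map (by fun_prop) (WithLp.measurable_toLp 2 _)]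
  exact (measurePreserving_eval (fun _ : Fin N => complexGaussian 1) i).map_eq

lemma integral_conj_mul_complexGaussianVec (i j : Fin N) :
    ∫ z : EuclideanSpace ℂ (Fin N), starRingEnd ℂ (z i) * z j ∂(complexGaussianVec N)
      = if i = j then 1 else 0 := by
  split_ifs with hij
  · subst hij
    have h := integral_conj_mul_complexGaussian 1
    rw [← (measurePreserving_apply_complexGaussianVec i).map_eq,
      integral_map (by fun_prop) (by fun_prop)] at h
    simpa using h
  · rw [complexGaussianVec, integral_map (WithLp.measurable_toLp 2 _).aemeasurable (by fun_prop)]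
    have hind := (iIndepFun_pi (μ := fun _ : Fin N => complexGaussian 1) (X := fun _ z => z)
      fun _ => aemeasurable_id).indepFun hij
    have hind' := hind.comp (φ := starRingEnd ℂ) (ψ := id) (by fun_prop) measurable_id
    have := hind'.integral_fun_mul_eq_mul_integral
      (Complex.continuous_conj.measurable.comp (measurable_pi_apply i)).aestronglyMeasurable
      (measurable_pi_apply j).aestronglyMeasurable
    simp only [Function.comp, id] at this
    rw [this, integral_comp_eval (μ := fun _ : Fin N => complexGaussian 1) (i := j)
      (f := fun z => z) (by fun_prop), integral_id_complexGaussian, mul_zero]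

/-- The noise coordinates `s * a + z i` are square integrable. -/
lemma memLp_noise_coord (v : ℝ≥0) (a : ℂ) (i : Fin N) :
    MemLp (fun p : ℂ × EuclideanSpace ℂ (Fin N) => p.1 * a + p.2 i) 2
      ((complexGaussian v).prod (complexGaussianVec N)) := by
  have h1 : MemLp (fun p : ℂ × EuclideanSpace ℂ (Fin N) => p.1) 2
      ((complexGaussian v).prod (complexGaussianVec N)) :=
    (memLp_id_complexGaussian v).comp_measurePreserving measurePreserving_fst
  have h2 : MemLp (fun p : ℂ × EuclideanSpace ℂ (Fin N) => p.2 i) 2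
      ((complexGaussian v).prod (complexGaussianVec N)) :=
    (memLp_id_complexGaussian 1).comp_measurePreserving
      ((measurePreserving_apply_complexGaussianVec i).comp measurePreserving_snd)
  exact (h1.mul_const a).add h2

lemma MemLp.conj {Ω : Type*} [MeasurableSpace Ω] {P : Measure Ω} {X : Ω → ℂ}
    (hX : MemLp X 2 P) : MemLp (fun ω => starRingEnd ℂ (X ω)) 2 P := hX.star

lemma integral_apply_complexGaussianVec (i : Fin N) :
    ∫ z : EuclideanSpace ℂ (Fin N), z i ∂(complexGaussianVec N) = 0 := by
  have h := integral_id_complexGaussian 1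
  rwa [← (measurePreserving_apply_complexGaussianVec i).map_eq,
    integral_map (by fun_prop) (by fun_prop)] at h

lemma integral_noise_coord (v : ℝ≥0) (a : ℂ) (i : Fin N) :
    ∫ p : ℂ × EuclideanSpace ℂ (Fin N), p.1 * a + p.2 i
      ∂((complexGaussian v).prod (complexGaussianVec N)) = 0 := by
  have h1 : Integrable (fun z : ℂ => z * a) (complexGaussian v) :=
    ((memLp_id_complexGaussian v).integrable (by norm_num)).mul_const a
  have h2 : Integrable (fun z : EuclideanSpace ℂ (Fin N) => z i) (complexGaussianVec N) :=
    ((memLp_id_complexGaussian 1).comp_measurePreserving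
      (measurePreserving_apply_complexGaussianVec i)).integrable (by norm_num)
  rw [integral_add (h1.comp_fst _) (h2.comp_snd _), integral_fun_fst (fun z : ℂ => z * a),
    integral_fun_snd (fun z : EuclideanSpace ℂ (Fin N) => z i), integral_mul_const,
    integral_id_complexGaussian, integral_apply_complexGaussianVec]
  simp

lemma integral_conj_mul_noise_coord (v : ℝ≥0) (a b : ℂ) (i j : Fin N) :
    ∫ p : ℂ × EuclideanSpace ℂ (Fin N),
        starRingEnd ℂ (p.1 * a + p.2 i) * (p.1 * b + p.2 j)
        ∂((complexGaussian v).prod (complexGaussianVec N))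
      = v * (starRingEnd ℂ a * b) + if i = j then 1 else 0 := by
  have hs := memLp_id_complexGaussian v
  have hz : ∀ k, MemLp (fun z : EuclideanSpace ℂ (Fin N) => z k) 2 (complexGaussianVec N) :=
    fun k => (memLp_id_complexGaussian 1).comp_measurePreserving
      (measurePreserving_apply_complexGaussianVec k)
  have hsi : Integrable (fun s : ℂ => s) (complexGaussian v) := hs.integrable (by norm_num)
  have hsc : Integrable (fun s : ℂ => starRingEnd ℂ s) (complexGaussian v) :=
    (MemLp.conj hs).integrable (by norm_num)
  have hzi := fun k => (hz k).integrable (by norm_num)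
  have hzc := fun k => (MemLp.conj (hz k)).integrable (by norm_num)
  have hss : Integrable (fun s : ℂ => starRingEnd ℂ s * s) (complexGaussian v) :=
    (MemLp.conj hs).integrable_mul hs
  have hzz : Integrable (fun z : EuclideanSpace ℂ (Fin N) => starRingEnd ℂ (z i) * z j)
      (complexGaussianVec N) := (MemLp.conj (hz i)).integrable_mul (hz j)
  have hpt : ∀ p : ℂ × EuclideanSpace ℂ (Fin N),
      starRingEnd ℂ (p.1 * a + p.2 i) * (p.1 * b + p.2 j)
      = ((starRingEnd ℂ p.1 * p.1) * (starRingEnd ℂ a * b) + starRingEnd ℂ (p.2 i) * p.2 j)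
        + ((starRingEnd ℂ p.1 * p.2 j) * starRingEnd ℂ a
          + (p.1 * starRingEnd ℂ (p.2 i)) * b) := by
    intro p
    simp only [map_add, map_mul]
    ring
  simp_rw [hpt]
  have i1 : Integrable (fun p : ℂ × EuclideanSpace ℂ (Fin N) =>
      (starRingEnd ℂ p.1 * p.1) * (starRingEnd ℂ a * b))
      ((complexGaussian v).prod (complexGaussianVec N)) := (hss.comp_fst _).mul_const _
  have i2 : Integrable (fun p : ℂ × EuclideanSpace ℂ (Fin N) => starRingEnd ℂ (p.2 i) * p.2 j)
      ((complexGaussian v).prod (complexGaussianVec N)) := hzz.comp_snd _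
  have i3 : Integrable (fun p : ℂ × EuclideanSpace ℂ (Fin N) =>
      (starRingEnd ℂ p.1 * p.2 j) * starRingEnd ℂ a)
      ((complexGaussian v).prod (complexGaussianVec N)) := (hsc.mul_prod (hzi j)).mul_const _
  have i4 : Integrable (fun p : ℂ × EuclideanSpace ℂ (Fin N) =>
      (p.1 * starRingEnd ℂ (p.2 i)) * b)
      ((complexGaussian v).prod (complexGaussianVec N)) := (hsi.mul_prod (hzc i)).mul_const _
  rw [integral_add (i1.fun_add i2) (i3.fun_add i4), integral_add i1 i2, integral_add i3 i4,
    integral_mul_const, integral_mul_const, integral_mul_const,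
    integral_prod_mul (fun s : ℂ => starRingEnd ℂ s) (fun z : EuclideanSpace ℂ (Fin N) => z j),
    integral_prod_mul (fun s : ℂ => s)
      (fun z : EuclideanSpace ℂ (Fin N) => starRingEnd ℂ (z i)),
    integral_fun_fst (fun s : ℂ => starRingEnd ℂ s * s),
    integral_fun_snd (fun z : EuclideanSpace ℂ (Fin N) => starRingEnd ℂ (z i) * z j),
    integral_apply_complexGaussianVec, integral_id_complexGaussian,
    integral_conj_mul_complexGaussian, integral_conj_mul_complexGaussianVec]
  simp

/-- The Hermitian form `y^H M y`. -/
noncomputable def quadForm (M : Matrix (Fin N) (Fin N) ℂ) (y : EuclideanSpace ℂ (Fin N)) : ℂ :=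
  star y.ofLp ⬝ᵥ (M *ᵥ y.ofLp)

lemma quadForm_eq_sum (M : Matrix (Fin N) (Fin N) ℂ) (y : EuclideanSpace ℂ (Fin N)) :
    quadForm M y = ∑ i, ∑ j, M i j * (starRingEnd ℂ (y i) * y j) := by
  simp only [quadForm, dotProduct, Matrix.mulVec, Finset.mul_sum]
  refine Finset.sum_congr rfl fun i _ => Finset.sum_congr rfl fun j _ => ?_
  simp only [Pi.star_apply, RCLike.star_def]
  ring

lemma continuous_quadForm (M : Matrix (Fin N) (Fin N) ℂ) : Continuous (quadForm M) := by
  have : quadForm M = fun y => ∑ i, ∑ j, M i j * (starRingEnd ℂ (y i) * y j) :=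
    funext (quadForm_eq_sum M)
  rw [this]
  have hc : ∀ i, Continuous fun y : EuclideanSpace ℂ (Fin N) => starRingEnd ℂ (y i) :=
    fun i => Complex.continuous_conj.comp (by fun_prop)
  fun_prop

lemma conj_mul_shifted_coord (σ : ℝ) (u v : EuclideanSpace ℂ (Fin N)) (i j : Fin N) :
    Integrable (fun y : EuclideanSpace ℂ (Fin N) => starRingEnd ℂ (y i) * y j) (mixLaw σ u v) ∧
    ∫ y : EuclideanSpace ℂ (Fin N), starRingEnd ℂ (y i) * y j ∂(mixLaw σ u v)
      = starRingEnd ℂ (u i) * u j + (σ ^ 2 : ℝ) * (starRingEnd ℂ (v i) * v j)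
        + if i = j then 1 else 0 := by
  set w : ℝ≥0 := Real.toNNReal (σ ^ 2)
  set τ := (complexGaussian w).prod (complexGaussianVec N)
  have hm := measurable_mixLaw_map u v
  have hsm : Measurable fun y : EuclideanSpace ℂ (Fin N) => starRingEnd ℂ (y i) * y j :=
    (Complex.continuous_conj.measurable.comp (by fun_prop)).mul (by fun_prop)
  have hX := fun k => memLp_noise_coord (N := N) w (v k) k
  have hXi := fun k => (hX k).integrable (q := 2) (by norm_num)
  have hXc := fun k => (MemLp.conj (hX k)).integrable (q := 2) (by norm_num)
  have hXX : Integrable (fun p : ℂ × EuclideanSpace ℂ (Fin N) =>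
      starRingEnd ℂ (p.1 * v i + p.2 i) * (p.1 * v j + p.2 j)) τ :=
    (MemLp.conj (hX i)).integrable_mul (hX j)
  have hpt : ∀ p : ℂ × EuclideanSpace ℂ (Fin N),
      starRingEnd ℂ ((u + p.1 • v + p.2) i) * (u + p.1 • v + p.2) j
      = (starRingEnd ℂ (u i) * u j
          + starRingEnd ℂ (p.1 * v i + p.2 i) * (p.1 * v j + p.2 j))
        + (starRingEnd ℂ (u i) * (p.1 * v j + p.2 j)
          + starRingEnd ℂ (p.1 * v i + p.2 i) * u j) := by
    intro p
    simp only [PiLp.add_apply, PiLp.smul_apply, smul_eq_mul, map_add, map_mul]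
    ring
  have i1 : Integrable (fun p : ℂ × EuclideanSpace ℂ (Fin N) => starRingEnd ℂ (u i) * u j
          + starRingEnd ℂ (p.1 * v i + p.2 i) * (p.1 * v j + p.2 j)) τ :=
    (integrable_const _).add hXX
  have i2 : Integrable (fun p : ℂ × EuclideanSpace ℂ (Fin N) =>
      starRingEnd ℂ (u i) * (p.1 * v j + p.2 j)) τ := (hXi j).const_mul _
  have i3 : Integrable (fun p : ℂ × EuclideanSpace ℂ (Fin N) =>
      starRingEnd ℂ (p.1 * v i + p.2 i) * u j) τ := (hXc i).mul_const _
  constructor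
  · rw [mixLaw, integrable_map_measure hsm.aestronglyMeasurable hm.aemeasurable]
    refine (i1.add (i2.add i3)).congr (Filter.Eventually.of_forall fun p => ?_)
    exact (hpt p).symm
  · rw [mixLaw, integral_map hm.aemeasurable hsm.aestronglyMeasurable]
    simp_rw [hpt]
    have hc0 : ∫ p : ℂ × EuclideanSpace ℂ (Fin N), (starRingEnd ℂ (p.1 * v i + p.2 i)) ∂τ = 0 := by
      rw [integral_conj (f := fun p : ℂ × EuclideanSpace ℂ (Fin N) => p.1 * v i + p.2 i),
        integral_noise_coord, map_zero]
    rw [integral_add i1 (i2.fun_add i3), integral_add i2 i3, integral_add (integrable_const _) hXX,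
      integral_const, integral_const_mul, integral_mul_const, hc0, integral_noise_coord,
      integral_conj_mul_noise_coord, Real.coe_toNNReal _ (sq_nonneg σ)]
    simp [add_assoc]

lemma integrable_quadForm (σ : ℝ) (u v : EuclideanSpace ℂ (Fin N))
    (M : Matrix (Fin N) (Fin N) ℂ) : Integrable (quadForm M) (mixLaw σ u v) := by
  have : quadForm M = fun y => ∑ i, ∑ j, M i j * (starRingEnd ℂ (y i) * y j) :=
    funext (quadForm_eq_sum M)
  rw [this]
  exact integrable_finsetSum _ fun i _ => integrable_finsetSum _ fun j _ =>
    (conj_mul_shifted_coord σ u v i j).1.const_mul _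

/-- The output has second moment matrix `I + u u^H + σ² v v^H`. With `u = F x`, `v = G x` and `M =
S` the value is `γ(S, x)`. -/
lemma integral_quadForm (σ : ℝ) (u v : EuclideanSpace ℂ (Fin N))
    (M : Matrix (Fin N) (Fin N) ℂ) :
    ∫ y, quadForm M y ∂(mixLaw σ u v)
      = M.trace + (quadForm M u + (σ ^ 2 : ℝ) * quadForm M v) := by
  have hi := fun i j => (conj_mul_shifted_coord σ u v i j).1.const_mul (M i j)
  simp_rw [quadForm_eq_sum]
  rw [integral_finsetSum _ fun i _ => integrable_finsetSum _ fun j _ => hi i j]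
  simp_rw [integral_finsetSum _ fun j _ => hi _ j, integral_const_mul,
    (conj_mul_shifted_coord σ u v _ _).2, mul_add, Finset.sum_add_distrib, Matrix.trace,
    Matrix.diag, Finset.mul_sum]
  simp only [mul_ite, mul_one, mul_zero, Finset.sum_ite_eq, Finset.mem_univ, if_true]
  rw [add_comm]
  congr 2
  refine Finset.sum_congr rfl fun i _ => Finset.sum_congr rfl fun j _ => ?_
  ring

/-! ### The reference density -/

lemma finrank_real_euclideanSpace_complex (N : ℕ) :
    Module.finrank ℝ (EuclideanSpace ℂ (Fin N)) = 2 * N := by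
  rw [finrank_real_of_complex, finrank_euclideanSpace_fin]

/-- The radial profile `‖y‖ ^ (2 (α - N)) exp (-‖y‖² / β)`. -/
noncomputable def radialProfile (N : ℕ) (α β t : ℝ) : ℝ :=
  Real.exp ((α - N) * Real.log t - t / β)

/-- The exponential form keeps the profile positive even at `t = 0`, where `Real.log 0 = 0` makes it
`1`. -/
lemma radialProfile_pos (N : ℕ) (α β t : ℝ) : 0 < radialProfile N α β t := Real.exp_pos _

lemma measurable_radialProfile (N : ℕ) (α β : ℝ) : Measurable (radialProfile N α β) := by
  unfold radialProfile
  exact Real.measurable_exp.comp (((Real.measurable_log).const_mul _).sub (by fun_prop))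

/-- The factor `r ^ (2 N - 1)` is the polar Jacobian in real dimension `2 N`. It cancels the `N` in
the profile and leaves a Gamma integrand of shape `α`. -/
lemma pow_mul_radialProfile_sq (hN : 1 ≤ N) (α β : ℝ) {r : ℝ} (hr : 0 < r) :
    r ^ (2 * N - 1) • radialProfile N α β (r ^ 2)
      = r ^ (2 * α - 1) * Real.exp (-(1 / β) * r ^ (2 : ℝ)) := by
  rw [smul_eq_mul, radialProfile, sub_eq_add_neg, Real.exp_add, ← mul_assoc, Real.log_pow]
  congr 1
  · rw [← Real.rpow_natCast, Real.rpow_def_of_pos hr, Real.rpow_def_of_pos hr, ← Real.exp_add]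
    congr 1
    push_cast [Nat.cast_sub (show 1 ≤ 2 * N by omega)]
    ring
  · rw [Real.rpow_two]
    congr 1
    ring

lemma integrable_radialProfile (hN : 1 ≤ N) {α β : ℝ} (hα : 0 < α) (hβ : 0 < β) :
    Integrable (fun y : EuclideanSpace ℂ (Fin N) => radialProfile N α β (‖y‖ ^ 2))
      (lebesgueVec N) := by
  have : Nonempty (Fin N) := ⟨⟨0, hN⟩⟩
  rw [integrable_fun_norm_addHaar (lebesgueVec N) (f := fun r => radialProfile N α β (r ^ 2)),
    finrank_real_euclideanSpace_complex]
  refine (integrableOn_rpow_mul_exp_neg_mul_rpow (p := 2) (s := 2 * α - 1) (b := 1 / β)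
    (by linarith) (by norm_num) (by positivity)).congr_fun (fun r hr => ?_) measurableSet_Ioi
  exact (pow_mul_radialProfile_sq hN α β hr).symm

lemma integral_radialProfile_eq (hN : 1 ≤ N) {α β : ℝ} (hα : 0 < α) (hβ : 0 < β) :
    ∫ y : EuclideanSpace ℂ (Fin N), radialProfile N α β (‖y‖ ^ 2) ∂(lebesgueVec N)
      = ((2 * N : ℕ) * (lebesgueVec N).real (Metric.ball 0 1) / 2)
        * (β ^ α * Real.Gamma α) := by
  have : Nonempty (Fin N) := ⟨⟨0, hN⟩⟩
  rw [integral_fun_norm_addHaar (lebesgueVec N) (fun r => radialProfile N α β (r ^ 2)),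
    finrank_real_euclideanSpace_complex,
    setIntegral_congr_fun measurableSet_Ioi fun r hr => pow_mul_radialProfile_sq hN α β hr,
    integral_rpow_mul_exp_neg_mul_rpow (by norm_num) (by linarith) (by positivity)]
  have h1 : (2 * α - 1 + 1) / 2 = α := by ring
  have h2 : -(2 * α - 1 + 1) / 2 = -α := by ring
  rw [h1, h2, one_div, Real.inv_rpow hβ.le, Real.rpow_neg hβ.le, inv_inv, nsmul_eq_mul,
    smul_eq_mul]
  ring

lemma integral_gaussDensity (N : ℕ) : ∫ y, gaussDensity N y ∂(lebesgueVec N) = 1 := by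
  have h0 : ∀ y, 0 ≤ gaussDensity N y := fun y => by unfold gaussDensity; positivity
  have h : (∫⁻ y, ENNReal.ofReal (gaussDensity N y) ∂(lebesgueVec N)) = 1 := by
    have := measure_univ (μ := complexGaussianVec N)
    rwa [complexGaussianVec_eq_withDensity, withDensity_apply _ MeasurableSet.univ,
      Measure.restrict_univ] at this
  rw [integral_eq_lintegral_of_nonneg_ae (Filter.Eventually.of_forall h0)
    (continuous_gaussDensity N).aestronglyMeasurable, h, ENNReal.toReal_one]

/-- The volume of the unit ball is never computed. At `α = N`, `β = 1` the profile is `π ^ N` times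
the standard Gaussian density, whose integral is `1`, and this calibrates the constant. -/
lemma integral_radialProfile (hN : 1 ≤ N) {α β : ℝ} (hα : 0 < α) (hβ : 0 < β) :
    ∫ y : EuclideanSpace ℂ (Fin N), radialProfile N α β (‖y‖ ^ 2) ∂(lebesgueVec N)
      = Real.pi ^ N / Real.Gamma N * (β ^ α * Real.Gamma α) := by
  have hN' : (0 : ℝ) < N := by exact_mod_cast hN
  have h1 := integral_radialProfile_eq hN hN' one_pos
  have h2 := integral_gaussDensity N
  have h3 : ∀ y : EuclideanSpace ℂ (Fin N),
      radialProfile N N 1 (‖y‖ ^ 2) = Real.pi ^ N * gaussDensity N y := by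
    intro y
    have : (Real.pi ^ N : ℝ) ≠ 0 := by positivity
    rw [gaussDensity, mul_inv_cancel_left₀ this, radialProfile]
    congr 1
    ring
  simp_rw [h3] at h1
  rw [integral_const_mul, h2, mul_one, Real.one_rpow, one_mul] at h1
  have hG : Real.Gamma N ≠ 0 := (Real.Gamma_pos_of_pos hN').ne'
  rw [integral_radialProfile_eq hN hα hβ, h1, mul_div_cancel_right₀ _ hG]

/-- The real Jacobian of a complex linear map is the field norm of its determinant; this is why `det
S = |det A|²` enters the normalization to the first power. -/
lemma det_restrictScalars_toEuclideanLin (A : Matrix (Fin N) (Fin N) ℂ) :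
    LinearMap.det ((Matrix.toEuclideanLin A).restrictScalars ℝ) = ‖A.det‖ ^ 2 := by
  have h : Matrix.toEuclideanLin A = Matrix.toLin (PiLp.basisFun 2 ℂ (Fin N))
      (PiLp.basisFun 2 ℂ (Fin N)) A := DFunLike.congr_fun (Matrix.toLpLin_eq_toLin 2 2) A
  rw [LinearMap.det_restrictScalars, h, LinearMap.det_toLin,
    Algebra.norm_complex_apply, Complex.normSq_eq_norm_sq]

lemma map_toEuclideanLin_lebesgueVec {A : Matrix (Fin N) (Fin N) ℂ} (hA : A.det ≠ 0) :
    (lebesgueVec N).map (Matrix.toEuclideanLin A)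
      = ENNReal.ofReal ((‖A.det‖ ^ 2)⁻¹) • lebesgueVec N := by
  have hd : LinearMap.det ((Matrix.toEuclideanLin A).restrictScalars ℝ) ≠ 0 := by
    rw [det_restrictScalars_toEuclideanLin]
    exact pow_ne_zero _ (norm_ne_zero_iff.2 hA)
  have h := Measure.map_linearMap_addHaar_eq_smul_addHaar (lebesgueVec N) hd
  rw [det_restrictScalars_toEuclideanLin, abs_of_nonneg (by positivity)] at h
  exact h

lemma quadForm_conjTranspose_mul_self (A : Matrix (Fin N) (Fin N) ℂ)
    (y : EuclideanSpace ℂ (Fin N)) :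
    quadForm (Aᴴ * A) y = ((‖Matrix.toEuclideanLin A y‖ ^ 2 : ℝ) : ℂ) := by
  have h : (‖Matrix.toEuclideanLin A y‖ ^ 2 : ℝ)
      = (inner ℂ (Matrix.toEuclideanLin A y) (Matrix.toEuclideanLin A y) : ℂ) := by
    rw [inner_self_eq_norm_sq_to_K]; norm_cast
  rw [h, EuclideanSpace.inner_eq_star_dotProduct, quadForm, ← Matrix.mulVec_mulVec,
    Matrix.dotProduct_mulVec, Matrix.vecMul_conjTranspose, star_star, dotProduct_comm]
  rfl

/-- The reference output density attached to `α`, `β` and `S`. -/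
noncomputable def refDensity (α β : ℝ) (S : Matrix (Fin N) (Fin N) ℂ)
    (y : EuclideanSpace ℂ (Fin N)) : ℝ :=
  (Real.pi ^ N)⁻¹ * (S.det.re * Real.Gamma N / (Real.Gamma α * β ^ α))
    * radialProfile N α β (quadForm S y).re

open scoped MatrixOrder Matrix.Norms.L2Operator in
lemma exists_eq_conjTranspose_mul_self {Q : Matrix (Fin N) (Fin N) ℂ} (hQ : Q.PosSemidef) :
    ∃ A : Matrix (Fin N) (Fin N) ℂ, Q = Aᴴ * A :=
  CStarAlgebra.nonneg_iff_eq_star_mul_self.mp hQ.nonneg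

lemma posDef_det_re_pos {S : Matrix (Fin N) (Fin N) ℂ} (hS : S.PosDef) : 0 < S.det.re :=
  (Complex.pos_iff.1 hS.det_pos).1

lemma refDensity_const_pos (hN : 1 ≤ N) {α β : ℝ} (hα : 0 < α) (hβ : 0 < β)
    {S : Matrix (Fin N) (Fin N) ℂ} (hS : S.PosDef) :
    0 < S.det.re * Real.Gamma N / (Real.Gamma α * β ^ α) := by
  have h1 := posDef_det_re_pos hS
  have h2 : 0 < Real.Gamma N := Real.Gamma_pos_of_pos (by exact_mod_cast hN)
  have h3 := Real.Gamma_pos_of_pos hα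
  positivity

lemma refDensity_pos (hN : 1 ≤ N) {α β : ℝ} (hα : 0 < α) (hβ : 0 < β)
    {S : Matrix (Fin N) (Fin N) ℂ} (hS : S.PosDef) (y : EuclideanSpace ℂ (Fin N)) :
    0 < refDensity α β S y :=
  mul_pos (mul_pos (by positivity) (refDensity_const_pos hN hα hβ hS)) (radialProfile_pos _ _ _ _)

lemma measurable_refDensity (α β : ℝ) (S : Matrix (Fin N) (Fin N) ℂ) :
    Measurable (refDensity α β S) :=
  ((measurable_radialProfile N α β).comp
    (Complex.measurable_re.comp (continuous_quadForm S).measurable)).const_mul _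

/-- Factor `S = A^H A`: then `y^H S y = ‖A y‖²`, and the substitution `y ↦ A y` reduces to the
radial integral. -/
lemma lintegral_refDensity (hN : 1 ≤ N) {α β : ℝ} (hα : 0 < α) (hβ : 0 < β)
    {S : Matrix (Fin N) (Fin N) ℂ} (hS : S.PosDef) :
    ∫⁻ y, ENNReal.ofReal (refDensity α β S y) ∂(lebesgueVec N) = 1 := by
  obtain ⟨A, rfl⟩ := exists_eq_conjTranspose_mul_self hS.posSemidef
  have hdet : ((Aᴴ * A).det).re = ‖A.det‖ ^ 2 := by
    rw [Matrix.det_mul, Matrix.det_conjTranspose, ← Complex.normSq_eq_norm_sq, RCLike.star_def,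
      ← Complex.normSq_eq_conj_mul_self, Complex.ofReal_re]
  have hd2 : 0 < ‖A.det‖ ^ 2 := hdet ▸ posDef_det_re_pos hS
  have hA : A.det ≠ 0 := fun h => by simp [h] at hd2
  set κ := (Real.pi ^ N)⁻¹ * ((Aᴴ * A).det.re * Real.Gamma N / (Real.Gamma α * β ^ α)) with hκ
  have hκ0 : 0 < κ := mul_pos (by positivity) (refDensity_const_pos hN hα hβ hS)
  have hm : Measurable fun y : EuclideanSpace ℂ (Fin N) =>
      ENNReal.ofReal (κ * radialProfile N α β (‖y‖ ^ 2)) :=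
    (((measurable_radialProfile N α β).comp (by fun_prop)).const_mul _).ennreal_ofReal
  have hpt : ∀ y, ENNReal.ofReal (refDensity α β (Aᴴ * A) y)
      = ENNReal.ofReal (κ * radialProfile N α β (‖Matrix.toEuclideanLin A y‖ ^ 2)) := by
    intro y
    rw [refDensity, quadForm_conjTranspose_mul_self, Complex.ofReal_re]
  simp_rw [hpt]
  rw [← lintegral_map (f := fun y => ENNReal.ofReal (κ * radialProfile N α β (‖y‖ ^ 2))) hm
    (continuous_toEuclideanLin A).measurable, map_toEuclideanLin_lebesgueVec hA,
    lintegral_smul_measure, ← ofReal_integral_eq_lintegral_ofReal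
      ((integrable_radialProfile hN hα hβ).const_mul κ)
      (Filter.Eventually.of_forall fun y => (mul_pos hκ0 (radialProfile_pos _ _ _ _)).le),
    integral_const_mul, integral_radialProfile hN hα hβ, smul_eq_mul,
    ← ENNReal.ofReal_mul (by positivity), hκ, hdet]
  have h2 : 0 < Real.Gamma N := Real.Gamma_pos_of_pos (by exact_mod_cast hN)
  have h3 := Real.Gamma_pos_of_pos hα
  have h4 : 0 < β ^ α := Real.rpow_pos_of_pos hβ α
  have h5 : (‖A.det‖) ≠ 0 := norm_ne_zero_iff.2 hA
  rw [← ENNReal.ofReal_one]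
  congr 1
  field_simp

/-! ### Conditional entropy and divergence -/

lemma integrable_fun_sub {Ω : Type*} [MeasurableSpace Ω] {P : Measure Ω} {f g : Ω → ℝ}
    (hf : Integrable f P) (hg : Integrable g P) : Integrable (fun ω => f ω - g ω) P := hf.sub hg

lemma quadForm_one (y : EuclideanSpace ℂ (Fin N)) :
    quadForm 1 y = ((‖y‖ ^ 2 : ℝ) : ℂ) := by
  have h := quadForm_conjTranspose_mul_self (1 : Matrix (Fin N) (Fin N) ℂ) y
  rw [Matrix.conjTranspose_one, one_mul] at h
  rw [h]
  simp [Matrix.toLpLin_one]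

lemma quadForm_vecMulVec (v y : EuclideanSpace ℂ (Fin N)) :
    quadForm (Matrix.vecMulVec v.ofLp (star v.ofLp)) y = ((‖inner ℂ v y‖ ^ 2 : ℝ) : ℂ) := by
  rw [quadForm, Matrix.vecMulVec_mulVec, ← Complex.normSq_eq_norm_sq,
    Complex.normSq_eq_conj_mul_self, EuclideanSpace.inner_eq_star_dotProduct]
  simp only [dotProduct, Finset.mul_sum, map_sum, Finset.sum_mul, Pi.smul_apply, Pi.star_apply,
    MulOpposite.smul_eq_mul_unop, MulOpposite.unop_op, map_mul, RCLike.star_def,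
    RingHomCompTriple.comp_apply,
    RingHom.id_apply]
  rw [Finset.sum_comm]
  refine Finset.sum_congr rfl fun i _ => Finset.sum_congr rfl fun j _ => ?_
  ring

lemma quadForm_re_pos {S : Matrix (Fin N) (Fin N) ℂ} (hS : S.PosDef)
    {y : EuclideanSpace ℂ (Fin N)} (hy : y ≠ 0) : 0 < (quadForm S y).re := by
  refine hS.re_dotProduct_pos (x := y.ofLp) fun h => hy ?_
  ext i
  exact congrFun h i

lemma quadForm_re_nonneg {S : Matrix (Fin N) (Fin N) ℂ} (hS : S.PosSemidef)
    (y : EuclideanSpace ℂ (Fin N)) : 0 ≤ (quadForm S y).re :=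
  hS.re_dotProduct_nonneg y.ofLp

lemma integrable_re_quadForm (σ : ℝ) (u v : EuclideanSpace ℂ (Fin N))
    (M : Matrix (Fin N) (Fin N) ℂ) :
    Integrable (fun y => (quadForm M y).re) (mixLaw σ u v) :=
  (integrable_quadForm σ u v M).re

lemma integral_re_quadForm (σ : ℝ) (u v : EuclideanSpace ℂ (Fin N))
    (M : Matrix (Fin N) (Fin N) ℂ) :
    ∫ y, (quadForm M y).re ∂(mixLaw σ u v)
      = M.trace.re + ((quadForm M u).re + σ ^ 2 * (quadForm M v).re) := by
  have h := integral_re (integrable_quadForm σ u v M)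
  rw [integral_quadForm] at h
  rw [show (fun y => (quadForm M y).re) = fun y => RCLike.re (quadForm M y) from rfl, h]
  simp only [RCLike.re_eq_complex_re, Complex.add_re, Complex.re_ofReal_mul]

lemma map_sub_mixLaw (σ : ℝ) (u v : EuclideanSpace ℂ (Fin N)) :
    (mixLaw σ u v).map (fun y => y - u) = mixLaw σ 0 v := by
  rw [mixLaw, Measure.map_map (by fun_prop) (measurable_mixLaw_map u v), mixLaw]
  congr 1
  ext1 p
  simp only [Function.comp]
  abel

lemma integrable_re_quadForm_sub (σ : ℝ) (u v : EuclideanSpace ℂ (Fin N))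
    (M : Matrix (Fin N) (Fin N) ℂ) :
    Integrable (fun y => (quadForm M (y - u)).re) (mixLaw σ u v) := by
  have h := integrable_re_quadForm σ 0 v M
  rw [← map_sub_mixLaw σ u v] at h
  exact h.comp_measurable (by fun_prop)

lemma integral_re_quadForm_sub (σ : ℝ) (u v : EuclideanSpace ℂ (Fin N))
    (M : Matrix (Fin N) (Fin N) ℂ) :
    ∫ y, (quadForm M (y - u)).re ∂(mixLaw σ u v)
      = M.trace.re + σ ^ 2 * (quadForm M v).re := by
  have h := integral_re_quadForm σ 0 v M
  have hm : Measurable fun y : EuclideanSpace ℂ (Fin N) => (quadForm M y).re :=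
    (Complex.continuous_re.comp (continuous_quadForm M)).measurable
  have h0 : quadForm M (0 : EuclideanSpace ℂ (Fin N)) = 0 := by simp [quadForm]
  rw [← map_sub_mixLaw σ u v, integral_map (by fun_prop)
    hm.aestronglyMeasurable, h0] at h
  simpa using h

/-- Both `‖y‖²` and `|⟨v, y⟩|²` are written as Hermitian forms, so that the mean of the logarithm
needs second moments only. -/
lemma log_mixDensity (σ : ℝ) (v y : EuclideanSpace ℂ (Fin N)) :
    Real.log (mixDensity σ v y) = -Real.log (Real.pi ^ N) - Real.log (1 + σ ^ 2 * ‖v‖ ^ 2)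
      - (quadForm 1 y).re + σ ^ 2 / (1 + σ ^ 2 * ‖v‖ ^ 2)
        * (quadForm (Matrix.vecMulVec v.ofLp (star v.ofLp)) y).re := by
  have hd := one_add_sq_mul_norm_sq_pos σ v
  rw [mixDensity, Real.log_mul (by positivity) (by positivity),
    Real.log_mul (by positivity) (by positivity), Real.log_inv, Real.log_inv, Real.log_exp,
    quadForm_one, quadForm_vecMulVec, Complex.ofReal_re, Complex.ofReal_re]
  ring

/-- This is the negative differential entropy of `CN(u, I + σ² v v^H)`, whose covariance has
determinant `1 + σ² ‖v‖²`. -/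
lemma integral_log_mixDensity (σ : ℝ) (u v : EuclideanSpace ℂ (Fin N)) :
    Integrable (fun y => Real.log (mixDensity σ v (y - u))) (mixLaw σ u v) ∧
    ∫ y, Real.log (mixDensity σ v (y - u)) ∂(mixLaw σ u v)
      = -Real.log (Real.pi ^ N) - Real.log (1 + σ ^ 2 * ‖v‖ ^ 2) - N := by
  have hd := one_add_sq_mul_norm_sq_pos σ v
  simp_rw [log_mixDensity]
  have i1 := integrable_re_quadForm_sub σ u v 1
  have i2 := (integrable_re_quadForm_sub σ u v
    (Matrix.vecMulVec v.ofLp (star v.ofLp))).const_mul (σ ^ 2 / (1 + σ ^ 2 * ‖v‖ ^ 2))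
  have i0 : Integrable (fun _ : EuclideanSpace ℂ (Fin N) =>
    -Real.log (Real.pi ^ N) - Real.log (1 + σ ^ 2 * ‖v‖ ^ 2)) (mixLaw σ u v) :=
    integrable_const _
  refine ⟨(integrable_fun_sub i0 i1).fun_add i2, ?_⟩
  have htr : (Matrix.vecMulVec v.ofLp (star v.ofLp)).trace.re = ‖v‖ ^ 2 := by
    rw [Matrix.trace_vecMulVec, ← EuclideanSpace.inner_eq_star_dotProduct,
      inner_self_eq_norm_sq_to_K]
    norm_cast
  have hin : ‖inner ℂ v v‖ = ‖v‖ ^ 2 := by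
    rw [inner_self_eq_norm_sq_to_K]
    simp
  rw [integral_add (integrable_fun_sub i0 i1) i2, integral_sub i0 i1, integral_const_mul,
    integral_re_quadForm_sub, integral_re_quadForm_sub, integral_const, quadForm_one,
    quadForm_vecMulVec, htr, Complex.ofReal_re, Complex.ofReal_re, hin, Matrix.trace_one]
  simp only [probReal_univ, one_smul, Fintype.card_fin, Complex.natCast_re]
  -- The forms contribute `-(N + σ²‖v‖²) + σ² (‖v‖² + σ²‖v‖⁴) / (1 + σ²‖v‖²) = -N`.
  field_simp
  ring

lemma log_refDensity (hN : 1 ≤ N) {α β : ℝ} (hα : 0 < α) (hβ : 0 < β)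
    {S : Matrix (Fin N) (Fin N) ℂ} (hS : S.PosDef) (y : EuclideanSpace ℂ (Fin N)) :
    Real.log (refDensity α β S y) = -Real.log (Real.pi ^ N) + Real.log S.det.re
      - Real.log (Real.Gamma α / Real.Gamma N) - α * Real.log β
      + (α - N) * Real.log (quadForm S y).re - (quadForm S y).re / β := by
  have h1 := posDef_det_re_pos hS
  have h2 : 0 < Real.Gamma N := Real.Gamma_pos_of_pos (by exact_mod_cast hN)
  have h3 := Real.Gamma_pos_of_pos hα
  have h4 : 0 < β ^ α := Real.rpow_pos_of_pos hβ α
  rw [refDensity, radialProfile, Real.log_mul (by positivity) (by positivity),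
    Real.log_mul (by positivity) (by positivity), Real.log_exp, Real.log_inv,
    Real.log_div (by positivity) (by positivity), Real.log_mul h1.ne' h2.ne',
    Real.log_mul h3.ne' h4.ne', Real.log_div h3.ne' h2.ne', Real.log_rpow hβ]
  ring

open InformationTheory in
/-- The divergence of the conditional output law from the reference density. -/
lemma lintegral_klFun_refDensity_le (hN : 1 ≤ N) (σ : ℝ) {α β γ : ℝ} (hα : 0 < α)
    (hαN : α ≤ N) (hβ : 0 < β) {S : Matrix (Fin N) (Fin N) ℂ} (hS : S.PosDef)
    (u v : EuclideanSpace ℂ (Fin N)) (hγ : 0 < γ)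
    (hγS : S.trace.re + ((quadForm S u).re + σ ^ 2 * (quadForm S v).re) = γ) {c : ℝ}
    (hc : c = α * Real.log β + Real.log (Real.Gamma α / Real.Gamma N) - N - Real.log S.det.re
      + ((N - α) * Real.log γ - Real.log (1 + σ ^ 2 * ‖v‖ ^ 2)) + γ / β) :
    0 ≤ c ∧ ∫⁻ y, ENNReal.ofReal (refDensity α β S y *
        klFun (mixDensity σ v (y - u) / refDensity α β S y)) ∂(lebesgueVec N)
      ≤ ENNReal.ofReal c := by
  set w : EuclideanSpace ℂ (Fin N) → ℝ := fun y => mixDensity σ v (y - u) with hw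
  set q := refDensity α β S with hq
  have hw0 : ∀ y, 0 < w y := fun y => mixDensity_pos _ _ _
  have hq0 : ∀ y, 0 < q y := refDensity_pos hN hα hβ hS
  have hwm : Measurable w := measurable_mixDensity_sub σ u v
  have hqm : Measurable q := measurable_refDensity α β S
  have hmix : mixLaw σ u v = (lebesgueVec N).withDensity fun y => ENNReal.ofReal (w y) :=
    mixLaw_eq_withDensity σ u v
  have hw1 : ∫⁻ y, ENNReal.ofReal (w y) ∂(lebesgueVec N) = 1 := by
    have := measure_univ (μ := mixLaw σ u v)
    rwa [hmix, withDensity_apply _ MeasurableSet.univ, Measure.restrict_univ] at this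
  have hq1 : ∫⁻ y, ENNReal.ofReal (q y) ∂(lebesgueVec N) = 1 := lintegral_refDensity hN hα hβ hS
  have hone : ∀ {f : EuclideanSpace ℂ (Fin N) → ℝ}, Measurable f → (∀ y, 0 < f y) →
      ∫⁻ y, ENNReal.ofReal (f y) ∂(lebesgueVec N) = 1 →
      Integrable f (lebesgueVec N) ∧ ∫ y, f y ∂(lebesgueVec N) = 1 := by
    intro f hf hf0 hf1
    have hnn : 0 ≤ᵐ[lebesgueVec N] f := Filter.Eventually.of_forall fun y => (hf0 y).le
    refine ⟨⟨hf.aestronglyMeasurable, ?_⟩, ?_⟩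
    · rw [hasFiniteIntegral_iff_ofReal hnn, hf1]
      exact ENNReal.one_lt_top
    · rw [integral_eq_lintegral_of_nonneg_ae hnn hf.aestronglyMeasurable, hf1, ENNReal.toReal_one]
  obtain ⟨hwi, hwI⟩ := hone hwm hw0 hw1
  obtain ⟨hqi, hqI⟩ := hone hqm hq0 hq1
  -- the linearized log-likelihood ratio
  set K : ℝ := Real.log (Real.pi ^ N) - Real.log S.det.re
    + Real.log (Real.Gamma α / Real.Gamma N) + α * Real.log β
    + (N - α) * (Real.log γ - 1) with hK
  set L : EuclideanSpace ℂ (Fin N) → ℝ := fun y =>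
    Real.log (w y) + (K + ((N - α) / γ + 1 / β) * (quadForm S y).re) with hL
  obtain ⟨hli, hlI⟩ := integral_log_mixDensity σ u v
  have hSi := integrable_re_quadForm σ u v S
  have hSI := integral_re_quadForm σ u v S
  have hKi : Integrable (fun y => K + ((N - α) / γ + 1 / β) * (quadForm S y).re)
      (mixLaw σ u v) := (integrable_const K).fun_add (hSi.const_mul _)
  have hLi : Integrable L (mixLaw σ u v) := hli.fun_add hKi
  have hLI : ∫ y, L y ∂(mixLaw σ u v) = c := by
    rw [hL, integral_add hli hKi, integral_add (integrable_const K) (hSi.const_mul _), hlI,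
      integral_const_mul, hSI, hγS, integral_const, hc, hK]
    simp only [probReal_univ, one_smul]
    field_simp
    ring
  have hwE := hwm.ennreal_ofReal
  have htr : ∀ y, (ENNReal.ofReal (w y)).toReal • L y = w y * L y := fun y => by
    rw [ENNReal.toReal_ofReal (hw0 y).le, smul_eq_mul]
  have hwLi : Integrable (fun y => w y * L y) (lebesgueVec N) := by
    rw [hmix, integrable_withDensity_iff_integrable_smul' hwE
      (Filter.Eventually.of_forall fun y => ENNReal.ofReal_lt_top)] at hLi
    simpa only [htr] using hLi
  have hwLI : ∫ y, w y * L y ∂(lebesgueVec N) = c := by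
    rw [hmix, integral_withDensity_eq_integral_toReal_smul hwE
      (Filter.Eventually.of_forall fun y => ENNReal.ofReal_lt_top)] at hLI
    simpa only [htr] using hLI
  -- The logarithmic inequality needs `y^H S y > 0`, which fails only at the origin, a null set
  -- since `N ≥ 1`.
  have hne : ∀ᵐ y ∂(lebesgueVec N), y ≠ 0 := by
    have : Nonempty (Fin N) := ⟨⟨0, hN⟩⟩
    simp [ae_iff]
  have hle : ∀ᵐ y ∂(lebesgueVec N), q y * klFun (w y / q y) ≤ w y * L y + (q y - w y) := by
    filter_upwards [hne] with y hy
    have ht : 0 < (quadForm S y).re := quadForm_re_pos hS hy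
    -- The tangent to `log` at the mean `γ` replaces Jensen: it integrates to exactly `log γ`, and
    -- `log (y^H S y)` itself need not be shown integrable. The sign of `N - α` allows the
    -- multiplication that follows.
    have hlog : Real.log (quadForm S y).re ≤ Real.log γ - 1 + (quadForm S y).re / γ := by
      have := Real.log_le_sub_one_of_pos (div_pos ht hγ)
      rw [Real.log_div ht.ne' hγ.ne'] at this
      linarith
    have hmul := mul_le_mul_of_nonneg_left hlog (sub_nonneg.2 hαN)
    have hLq : Real.log (w y) - Real.log (q y) ≤ L y := by
      rw [hL, hq, log_refDensity hN hα hβ hS, hK]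
      have e1 : ((N - α) / γ + 1 / β) * (quadForm S y).re
          = (N - α) * ((quadForm S y).re / γ) + (quadForm S y).re / β := by ring
      simp only [e1]
      linarith
    have := mul_le_mul_of_nonneg_left hLq (hw0 y).le
    have e2 : q y * klFun (w y / q y)
        = w y * (Real.log (w y) - Real.log (q y)) + (q y - w y) := by
      rw [klFun_apply, Real.log_div (hw0 y).ne' (hq0 y).ne']
      have := (hq0 y).ne'
      field_simp
      ring
    rw [e2]
    linarith
  have hnn : 0 ≤ᵐ[lebesgueVec N] fun y => w y * L y + (q y - w y) := by
    filter_upwards [hle] with y hy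
    exact (mul_nonneg (hq0 y).le (klFun_nonneg (div_pos (hw0 y) (hq0 y)).le)).trans hy
  have hTi : Integrable (fun y => w y * L y + (q y - w y)) (lebesgueVec N) :=
    hwLi.fun_add (integrable_fun_sub hqi hwi)
  have hTI : ∫ y, (w y * L y + (q y - w y)) ∂(lebesgueVec N) = c := by
    rw [integral_add hwLi (integrable_fun_sub hqi hwi), integral_sub hqi hwi, hwLI, hwI, hqI]
    ring
  refine ⟨hTI ▸ integral_nonneg_of_ae hnn, ?_⟩
  calc _ ≤ ∫⁻ y, ENNReal.ofReal (w y * L y + (q y - w y)) ∂(lebesgueVec N) :=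
        lintegral_mono_ae (hle.mono fun y hy => ENNReal.ofReal_le_ofReal hy)
    _ = ENNReal.ofReal c := by
        rw [← ofReal_integral_eq_lintegral_ofReal hTi hnn, hTI]

/-! ### The form `γ(S, x)` and second moments of the input -/

lemma quadForm_add (M M' : Matrix (Fin N) (Fin N) ℂ) (x : EuclideanSpace ℂ (Fin N)) :
    quadForm (M + M') x = quadForm M x + quadForm M' x := by
  rw [quadForm, Matrix.add_mulVec, dotProduct_add]; rfl

lemma quadForm_smul (c : ℂ) (M : Matrix (Fin N) (Fin N) ℂ) (x : EuclideanSpace ℂ (Fin N)) :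
    quadForm (c • M) x = c * quadForm M x := by
  rw [quadForm, Matrix.smul_mulVec, dotProduct_smul]; rfl

lemma quadForm_toEuclideanLin (S F : Matrix (Fin N) (Fin N) ℂ) (x : EuclideanSpace ℂ (Fin N)) :
    quadForm S (Matrix.toEuclideanLin F x) = quadForm (Fᴴ * S * F) x := by
  have h : (Matrix.toEuclideanLin F x).ofLp = F *ᵥ x.ofLp := rfl
  rw [quadForm, h, quadForm, ← Matrix.mulVec_mulVec, ← Matrix.mulVec_mulVec,
    Matrix.dotProduct_mulVec (star x.ofLp) Fᴴ, Matrix.vecMul_conjTranspose, star_star]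

/-- The matrix `F^H S F + σ² G^H S G` of the form `γ(S, ·)`. -/
noncomputable def gamMatrix (F G : Matrix (Fin N) (Fin N) ℂ) (σ : ℝ)
    (S : Matrix (Fin N) (Fin N) ℂ) : Matrix (Fin N) (Fin N) ℂ :=
  Fᴴ * S * F + ((σ ^ 2 : ℝ) : ℂ) • (Gᴴ * S * G)

lemma gam_eq (F G : Matrix (Fin N) (Fin N) ℂ) (σ : ℝ) (S : Matrix (Fin N) (Fin N) ℂ)
    (x : EuclideanSpace ℂ (Fin N)) :
    gam F G σ S x = S.trace.re + (quadForm (gamMatrix F G σ S) x).re := rfl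

lemma gam_eq_add (F G : Matrix (Fin N) (Fin N) ℂ) (σ : ℝ) (S : Matrix (Fin N) (Fin N) ℂ)
    (x : EuclideanSpace ℂ (Fin N)) :
    S.trace.re + ((quadForm S (Matrix.toEuclideanLin F x)).re
      + σ ^ 2 * (quadForm S (Matrix.toEuclideanLin G x)).re) = gam F G σ S x := by
  rw [gam_eq, gamMatrix, quadForm_add, quadForm_smul, Complex.add_re, Complex.re_ofReal_mul,
    quadForm_toEuclideanLin, quadForm_toEuclideanLin]

lemma trace_re_pos (hN : 1 ≤ N) {S : Matrix (Fin N) (Fin N) ℂ} (hS : S.PosDef) :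
    0 < S.trace.re := by
  have : Nonempty (Fin N) := ⟨⟨0, hN⟩⟩
  exact (Complex.pos_iff.1 hS.trace_pos).1

lemma trace_re_le_gam (F G : Matrix (Fin N) (Fin N) ℂ) (σ : ℝ)
    {S : Matrix (Fin N) (Fin N) ℂ} (hS : S.PosSemidef) (x : EuclideanSpace ℂ (Fin N)) :
    S.trace.re ≤ gam F G σ S x := by
  rw [← gam_eq_add]
  have h1 := quadForm_re_nonneg hS (Matrix.toEuclideanLin F x)
  have h2 := mul_nonneg (sq_nonneg σ) (quadForm_re_nonneg hS (Matrix.toEuclideanLin G x))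
  linarith

lemma continuous_gam (F G : Matrix (Fin N) (Fin N) ℂ) (σ : ℝ) (S : Matrix (Fin N) (Fin N) ℂ) :
    Continuous (gam F G σ S) :=
  continuous_const.add (Complex.continuous_re.comp (continuous_quadForm (gamMatrix F G σ S)))

/-- `E[x x^H]`. -/
noncomputable def inputCov (μ : Measure (EuclideanSpace ℂ (Fin N))) :
    Matrix (Fin N) (Fin N) ℂ :=
  Matrix.of fun i j => ∫ x, starRingEnd ℂ (x j) * x i ∂μ

section InputLaws

variable {P : ℝ} {μ : Measure (EuclideanSpace ℂ (Fin N))}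

lemma integrable_norm_sq_of_mem_inputLaws (hμ : μ ∈ inputLaws N P) :
    Integrable (fun x => ‖x‖ ^ 2) μ := by
  refine ⟨by fun_prop, ?_⟩
  rw [hasFiniteIntegral_iff_enorm]
  simp only [enorm_pow, enorm_norm]
  exact hμ.2.trans_lt ENNReal.ofReal_lt_top

lemma integral_norm_sq_le_of_mem_inputLaws (hP : 0 ≤ P) (hμ : μ ∈ inputLaws N P) :
    ∫ x, ‖x‖ ^ 2 ∂μ ≤ P := by
  rw [integral_eq_lintegral_of_nonneg_ae (Filter.Eventually.of_forall fun x => by positivity)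
    (by fun_prop)]
  refine ENNReal.toReal_le_of_le_ofReal hP (le_trans (le_of_eq ?_) hμ.2)
  refine lintegral_congr fun x => ?_
  rw [ENNReal.ofReal_pow (norm_nonneg _), ofReal_norm]

lemma integrable_conj_mul_of_mem_inputLaws (hμ : μ ∈ inputLaws N P) (i j : Fin N) :
    Integrable (fun x : EuclideanSpace ℂ (Fin N) => starRingEnd ℂ (x i) * x j) μ := by
  have h : ∀ k, MemLp (fun x : EuclideanSpace ℂ (Fin N) => x k) 2 μ := by
    intro k
    have h2 : MemLp (fun x : EuclideanSpace ℂ (Fin N) => x) 2 μ :=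
      (memLp_two_iff_integrable_sq_norm (by fun_prop)).2 (integrable_norm_sq_of_mem_inputLaws hμ)
    exact h2.of_le (by fun_prop) (Filter.Eventually.of_forall fun x => PiLp.norm_apply_le x k)
  exact (MemLp.conj (h i)).integrable_mul (h j)

lemma integral_quadForm_of_mem_inputLaws (hμ : μ ∈ inputLaws N P)
    (M : Matrix (Fin N) (Fin N) ℂ) :
    Integrable (quadForm M) μ ∧ ∫ x, quadForm M x ∂μ = (M * inputCov μ).trace := by
  have hi := fun i j => (integrable_conj_mul_of_mem_inputLaws hμ i j).const_mul (M i j)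
  have hs : ∀ i, Integrable (fun x : EuclideanSpace ℂ (Fin N) =>
      ∑ j, M i j * (starRingEnd ℂ (x i) * x j)) μ := fun i =>
    integrable_finsetSum _ fun j _ => hi i j
  have hq : quadForm M = fun y => ∑ i, ∑ j, M i j * (starRingEnd ℂ (y i) * y j) :=
    funext (quadForm_eq_sum M)
  rw [hq]
  refine ⟨integrable_finsetSum _ fun i _ => hs i, ?_⟩
  rw [integral_finsetSum _ fun i _ => hs i]
  simp_rw [integral_finsetSum _ fun j _ => hi _ j, integral_const_mul]
  simp only [Matrix.trace, Matrix.diag, Matrix.mul_apply, inputCov, Matrix.of_apply]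

/-- The Hermitian form of `E[x x^H]` at `c` is `E |⟨c, x⟩|²`. -/
lemma posSemidef_inputCov (hμ : μ ∈ inputLaws N P) : (inputCov μ).PosSemidef := by
  refine Matrix.PosSemidef.of_dotProduct_mulVec_nonneg ?_ fun c => ?_
  · ext i j
    simp only [Matrix.conjTranspose_apply, inputCov, Matrix.of_apply, RCLike.star_def]
    rw [← integral_conj]
    refine integral_congr_ae (Filter.Eventually.of_forall fun x => ?_)
    simp [mul_comm]
  · have h := (integral_quadForm_of_mem_inputLaws hμ (Matrix.vecMulVec c (star c))).2
    rw [Matrix.vecMulVec_mul, Matrix.trace_vecMulVec, dotProduct_comm,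
      ← Matrix.dotProduct_mulVec] at h
    rw [← h]
    have hpt : ∀ x, quadForm (Matrix.vecMulVec c (star c)) x
        = ((‖inner ℂ (WithLp.toLp 2 c) x‖ ^ 2 : ℝ) : ℂ) :=
      fun x => quadForm_vecMulVec (WithLp.toLp 2 c) x
    simp_rw [hpt]
    rw [integral_complex_ofReal]
    exact Complex.zero_le_real.2 (integral_nonneg fun x => by positivity)

lemma inputCov_mem_covariances (hP : 0 ≤ P) (hμ : μ ∈ inputLaws N P) :
    inputCov μ ∈ covariances N P := by
  refine ⟨posSemidef_inputCov hμ, ?_⟩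
  have h := (integral_quadForm_of_mem_inputLaws hμ 1).2
  simp_rw [quadForm_one] at h
  rw [one_mul, integral_complex_ofReal] at h
  rw [← h, Complex.ofReal_re]
  exact integral_norm_sq_le_of_mem_inputLaws hP hμ

/-- Cyclicity of the trace. With `Q = E[x x^H]` the left side is the mean of `γ(S, x)`, and the
right side is `α β` up to taking real parts. -/
lemma trace_gamMatrix_mul (F G S Q : Matrix (Fin N) (Fin N) ℂ) (σ : ℝ) :
    S.trace + (gamMatrix F G σ S * Q).trace = (S * outputCov F G σ Q).trace := by
  have h : ∀ H : Matrix (Fin N) (Fin N) ℂ,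
      (Hᴴ * S * H * Q).trace = (S * (H * Q * Hᴴ)).trace := by
    intro H
    rw [Matrix.mul_assoc (Hᴴ * S), Matrix.mul_assoc Hᴴ, Matrix.trace_mul_comm Hᴴ,
      Matrix.mul_assoc S]
  rw [gamMatrix, outputCov, add_mul, mul_add, mul_add, mul_one, smul_mul_assoc, mul_smul_comm,
    Matrix.trace_add, Matrix.trace_add, Matrix.trace_add, Matrix.trace_smul, Matrix.trace_smul,
    h F, h G, add_assoc]

lemma integral_gam_of_mem_inputLaws (hμ : μ ∈ inputLaws N P)
    (F G : Matrix (Fin N) (Fin N) ℂ) (σ : ℝ) (S : Matrix (Fin N) (Fin N) ℂ) :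
    Integrable (gam F G σ S) μ ∧
      ∫ x, gam F G σ S x ∂μ = (S * outputCov F G σ (inputCov μ)).trace.re := by
  have := hμ.1
  obtain ⟨hi, hI⟩ := integral_quadForm_of_mem_inputLaws hμ (gamMatrix F G σ S)
  have hre : Integrable (fun x => (quadForm (gamMatrix F G σ S) x).re) μ := hi.re
  refine ⟨(integrable_const S.trace.re).fun_add hre, ?_⟩
  simp_rw [gam_eq]
  have h := integral_re hi
  rw [hI] at h
  rw [integral_add (integrable_const S.trace.re) hre, integral_const,
    ← trace_gamMatrix_mul, Complex.add_re]
  simp only [probReal_univ, one_smul]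
  exact congrArg _ h

end InputLaws

/-! ### The bound for a fixed input law -/

lemma posSemidef_outputCov_sub_one (F G : Matrix (Fin N) (Fin N) ℂ) (σ : ℝ)
    {Q : Matrix (Fin N) (Fin N) ℂ} (hQ : Q.PosSemidef) :
    (F * Q * Fᴴ + ((σ ^ 2 : ℝ) : ℂ) • (G * Q * Gᴴ)).PosSemidef :=
  (hQ.mul_mul_conjTranspose_same F).add ((hQ.mul_mul_conjTranspose_same G).smul
    (Complex.zero_le_real.2 (sq_nonneg σ)))

lemma posDef_outputCov (F G : Matrix (Fin N) (Fin N) ℂ) (σ : ℝ)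
    {Q : Matrix (Fin N) (Fin N) ℂ} (hQ : Q.PosSemidef) : (outputCov F G σ Q).PosDef := by
  rw [outputCov, add_assoc]
  exact Matrix.PosDef.one.add_posSemidef (posSemidef_outputCov_sub_one F G σ hQ)

/-- With `S = A^H A`, the trace equals that of `A R A^H ⪰ 0`. -/
lemma trace_mul_re_nonneg {S R : Matrix (Fin N) (Fin N) ℂ} (hS : S.PosSemidef)
    (hR : R.PosSemidef) : 0 ≤ (S * R).trace.re := by
  obtain ⟨A, rfl⟩ := exists_eq_conjTranspose_mul_self hS
  rw [Matrix.mul_assoc, Matrix.trace_mul_comm]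
  exact (Complex.nonneg_iff.1 (hR.mul_mul_conjTranspose_same A).trace_nonneg).1

lemma trace_mul_outputCov_pos (hN : 1 ≤ N) (F G : Matrix (Fin N) (Fin N) ℂ) (σ : ℝ)
    {Q S : Matrix (Fin N) (Fin N) ℂ} (hQ : Q.PosSemidef) (hS : S.PosDef) :
    0 < (S * outputCov F G σ Q).trace.re := by
  rw [outputCov, add_assoc, mul_add, mul_one, Matrix.trace_add, Complex.add_re]
  exact add_pos_of_pos_of_nonneg (trace_re_pos hN hS)
    (trace_mul_re_nonneg hS.posSemidef (posSemidef_outputCov_sub_one F G σ hQ))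

lemma beta_pos (hN : 1 ≤ N) (F G : Matrix (Fin N) (Fin N) ℂ) (σ : ℝ) {α : ℝ} (hα : 0 < α)
    {Q S : Matrix (Fin N) (Fin N) ℂ} (hQ : Q.PosSemidef) (hS : S.PosDef) :
    0 < beta F G σ α Q S :=
  mul_pos (by positivity) (trace_mul_outputCov_pos hN F G σ hQ hS)

/-- The duality upper bound on the mutual information of a given input law. -/
lemma mutualInfo_jointLaw_le (hN : 1 ≤ N) (F G : Matrix (Fin N) (Fin N) ℂ) (σ : ℝ) {P : ℝ}
    {μ : Measure (EuclideanSpace ℂ (Fin N))} (hμ : μ ∈ inputLaws N P)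
    {α : ℝ} (hα : 0 < α) (hαN : α ≤ N) {S : Matrix (Fin N) (Fin N) ℂ} (hS : S.PosDef) {B : ℝ}
    (hB : ∀ᵐ x ∂μ, Real.log (gam F G σ S x ^ ((N : ℝ) - α) /
          (1 + σ ^ 2 * ‖Matrix.toEuclideanLin G x‖ ^ 2)) ≤ B) {V : ℝ}
    (hV : V = α * Real.log (beta F G σ α (inputCov μ) S)
      + Real.log (Real.Gamma α / Real.Gamma N) + α - N - Real.log S.det.re + B) :
    0 ≤ V ∧ mutualInfo (jointLaw F G σ μ) ≤ ENNReal.ofReal V := by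
  have := hμ.1
  have hβ := beta_pos hN F G σ hα (posSemidef_inputCov hμ) hS
  set β := beta F G σ α (inputCov μ) S with hβdef
  have hg0 : ∀ x, 0 < gam F G σ S x := fun x =>
    (trace_re_pos hN hS).trans_le (trace_re_le_gam F G σ hS.posSemidef x)
  obtain ⟨hgi, hgI⟩ := integral_gam_of_mem_inputLaws hμ F G σ S
  -- The mean of `γ(S, x) / β` is `α`, so `V` is the mean of `D + γ(S, x) / β`.
  set D := V - α with hD
  have hc := fun x => lintegral_klFun_refDensity_le hN σ hα hαN hβ hS
    (Matrix.toEuclideanLin F x) (Matrix.toEuclideanLin G x) (hg0 x) (gam_eq_add F G σ S x) rfl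
  have hle : ∀ᵐ x ∂μ, α * Real.log β + Real.log (Real.Gamma α / Real.Gamma N) - N
      - Real.log S.det.re + ((N - α) * Real.log (gam F G σ S x)
      - Real.log (1 + σ ^ 2 * ‖Matrix.toEuclideanLin G x‖ ^ 2)) + gam F G σ S x / β
      ≤ D + gam F G σ S x / β := by
    filter_upwards [hB] with x hx
    rw [Real.log_div (Real.rpow_pos_of_pos (hg0 x) _).ne'
      (one_add_sq_mul_norm_sq_pos σ _).ne', Real.log_rpow (hg0 x)] at hx
    rw [hD, hV]
    linarith
  have hgβ : Integrable (fun x => gam F G σ S x / β) μ := hgi.div_const β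
  have hTi : Integrable (fun x => D + gam F G σ S x / β) μ := (integrable_const D).fun_add hgβ
  have hTI : ∫ x, (D + gam F G σ S x / β) ∂μ = V := by
    rw [integral_add (integrable_const D) hgβ, integral_div, hgI, integral_const]
    have hαβ : (S * outputCov F G σ (inputCov μ)).trace.re = α * β := by
      rw [hβdef, beta]
      field_simp
    rw [hαβ, mul_div_cancel_right₀ _ hβ.ne', hD]
    simp
  have hnn : 0 ≤ᵐ[μ] fun x => D + gam F G σ S x / β := by
    filter_upwards [hle] with x hx
    exact (hc x).1.trans hx
  refine ⟨hTI ▸ integral_nonneg_of_ae hnn, ?_⟩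
  rw [jointLaw_eq_withDensity]
  refine (mutualInfo_withDensity_le μ (lebesgueVec N)
    (w := fun x y => mixDensity σ (Matrix.toEuclideanLin G x) (y - Matrix.toEuclideanLin F x))
    (measurable_channelDensity F G σ) (fun x y => mixDensity_pos _ _ _)
    (fun x y => mixDensity_le _ _ _) (fun x => ?_) (measurable_refDensity α β S)
    (refDensity_pos hN hα hβ hS)).trans ?_
  · have h1 := measure_univ (μ := mixLaw σ (Matrix.toEuclideanLin F x) (Matrix.toEuclideanLin G x))
    rwa [mixLaw_eq_withDensity, withDensity_apply _ MeasurableSet.univ,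
      Measure.restrict_univ] at h1
  · calc _ ≤ ∫⁻ x, ENNReal.ofReal (D + gam F G σ S x / β) ∂μ :=
          lintegral_mono_ae (hle.mono fun x hx => (hc x).2.trans (ENNReal.ofReal_le_ofReal hx))
      _ = ENNReal.ofReal V := by
          rw [← ofReal_integral_eq_lintegral_ofReal hTi hnn, hTI]

/-! ### Compactness and attainment of the maxima -/

lemma trace_conjTranspose_mul_self_re (A : Matrix (Fin N) (Fin N) ℂ) :
    (Aᴴ * A).trace.re = ∑ j, ∑ i, ‖A i j‖ ^ 2 := by
  simp only [Matrix.trace, Matrix.diag, Matrix.mul_apply, Matrix.conjTranspose_apply,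
    Complex.re_sum]
  refine Finset.sum_congr rfl fun j _ => Finset.sum_congr rfl fun i _ => ?_
  rw [RCLike.star_def, ← Complex.normSq_eq_conj_mul_self, Complex.ofReal_re,
    Complex.normSq_eq_norm_sq]

/-- The set is the continuous image under `A ↦ A^H A` of the matrices with `tr (A^H A) ≤ P`. That
trace is the sum of the `|A i j|²`, so these matrices form a closed set with entries bounded by
`√P`. -/
lemma isCompact_covariances (N : ℕ) (P : ℝ) : IsCompact (covariances N P) := by
  have hc : Continuous fun A : Matrix (Fin N) (Fin N) ℂ => Aᴴ * A :=
    (continuous_id.matrix_conjTranspose).matrix_mul continuous_id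
  have himg : covariances N P
      = (fun A : Matrix (Fin N) (Fin N) ℂ => Aᴴ * A) '' {A | (Aᴴ * A).trace.re ≤ P} := by
    ext Q
    constructor
    · rintro ⟨hQ, hP⟩
      obtain ⟨A, rfl⟩ := exists_eq_conjTranspose_mul_self hQ
      exact ⟨A, hP, rfl⟩
    · rintro ⟨A, hA, rfl⟩
      exact ⟨Matrix.posSemidef_conjTranspose_mul_self A, hA⟩
  rw [himg]
  refine IsCompact.image ?_ hc
  have hbox : IsCompact (Set.univ.pi fun _ : Fin N => Set.univ.pi fun _ : Fin N =>
      Metric.closedBall (0 : ℂ) (√P)) :=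
    isCompact_univ_pi fun _ => isCompact_univ_pi fun _ => isCompact_closedBall _ _
  refine hbox.of_isClosed_subset
    (isClosed_le (Complex.continuous_re.comp hc.matrix_trace) continuous_const)
    fun (A : Matrix (Fin N) (Fin N) ℂ) (hA : (Aᴴ * A).trace.re ≤ P) i _ j _ => ?_
  rw [mem_closedBall_zero_iff]
  refine Real.le_sqrt_of_sq_le ?_
  rw [trace_conjTranspose_mul_self_re] at hA
  refine le_trans ?_ hA
  calc ‖A i j‖ ^ 2 ≤ ∑ i, ‖A i j‖ ^ 2 :=
        Finset.single_le_sum (f := fun i => ‖A i j‖ ^ 2) (fun _ _ => by positivity)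
          (Finset.mem_univ i)
    _ ≤ _ := Finset.single_le_sum (f := fun j => ∑ i, ‖A i j‖ ^ 2)
          (fun _ _ => Finset.sum_nonneg fun _ _ => by positivity) (Finset.mem_univ j)

lemma zero_mem_covariances {P : ℝ} (hP : 0 ≤ P) : 0 ∈ covariances N P :=
  ⟨Matrix.PosSemidef.zero, by simpa using hP⟩

lemma continuous_outputCov (F G : Matrix (Fin N) (Fin N) ℂ) (σ : ℝ) :
    Continuous (outputCov F G σ) := by
  have h : ∀ H : Matrix (Fin N) (Fin N) ℂ,
      Continuous fun Q : Matrix (Fin N) (Fin N) ℂ => H * Q * Hᴴ := fun H =>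
    (continuous_const.matrix_mul continuous_id).matrix_mul continuous_const
  have hG : Continuous fun Q : Matrix (Fin N) (Fin N) ℂ =>
      ((σ ^ 2 : ℝ) : ℂ) • (G * Q * Gᴴ) :=
    (continuous_const_smul ((σ ^ 2 : ℝ) : ℂ)).comp (h G)
  exact (continuous_const.add (h F)).add hG

/-- The supremum over the ball does not involve `Q`, so only `log β` varies. -/
lemma continuousOn_rateUB (hN : 1 ≤ N) (F G : Matrix (Fin N) (Fin N) ℂ) (σ r P : ℝ) {α : ℝ}
    (hα : 0 < α) {S : Matrix (Fin N) (Fin N) ℂ} (hS : S.PosDef) :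
    ContinuousOn (fun Q => rateUB F G σ r α S Q) (covariances N P) := by
  have hβ : Continuous fun Q => beta F G σ α Q S :=
    continuous_const.mul (Complex.continuous_re.comp
      (continuous_const.matrix_mul (continuous_outputCov F G σ)).matrix_trace)
  have hlog : ContinuousOn (fun Q => Real.log (beta F G σ α Q S)) (covariances N P) :=
    hβ.continuousOn.log fun Q hQ => (beta_pos hN F G σ hα hQ.1 hS).ne'
  unfold rateUB
  fun_prop

lemma continuousOn_logDetUB (F G : Matrix (Fin N) (Fin N) ℂ) (σ P : ℝ) :
    ContinuousOn (logDetUB F G σ) (covariances N P) :=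
  (Complex.continuous_re.comp (continuous_outputCov F G σ).matrix_det).continuousOn.log
    fun _ hQ => (posDef_det_re_pos (posDef_outputCov F G σ hQ.1)).ne'

/-- An infimum of continuous functions is upper semicontinuous, hence attains its maximum on a
compact set. Working in `EReal` avoids any lower bound on the infimum. -/
lemma exists_isGreatest_infRateUB (hN : 1 ≤ N) (F G : Matrix (Fin N) (Fin N) ℂ) (σ r : ℝ)
    {P : ℝ} (hP : 0 ≤ P) : ∃ M : EReal, IsGreatest (infRateUB F G σ r '' covariances N P) M := by
  have husc : UpperSemicontinuousOn (infRateUB F G σ r) (covariances N P) := by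
    refine upperSemicontinuousOn_iInf fun α => upperSemicontinuousOn_iInf fun hα =>
      upperSemicontinuousOn_iInf fun S => upperSemicontinuousOn_iInf fun hS => ?_
    exact (continuous_coe_real_ereal.comp_continuousOn
      (continuousOn_rateUB hN F G σ r P hα.1 hS)).upperSemicontinuousOn
  obtain ⟨Q, hQ, hmax⟩ := husc.exists_isMaxOn ⟨0, zero_mem_covariances hP⟩
    (isCompact_covariances N P)
  exact ⟨_, ⟨Q, hQ, rfl⟩, by rintro _ ⟨Q', hQ', rfl⟩; exact hmax hQ'⟩

lemma exists_isGreatest_logDetUB (F G : Matrix (Fin N) (Fin N) ℂ) (σ : ℝ)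
    {P : ℝ} (hP : 0 ≤ P) : ∃ M : ℝ, IsGreatest (logDetUB F G σ '' covariances N P) M := by
  obtain ⟨Q, hQ, hmax⟩ := (isCompact_covariances N P).exists_isMaxOn
    ⟨0, zero_mem_covariances hP⟩ (continuousOn_logDetUB F G σ P)
  exact ⟨_, ⟨Q, hQ, rfl⟩, by rintro _ ⟨Q', hQ', rfl⟩; exact hmax hQ'⟩

/-! ### The whitening choice of `S` -/

section Whitening

variable (F G : Matrix (Fin N) (Fin N) ℂ) (σ : ℝ) {Q : Matrix (Fin N) (Fin N) ℂ}

lemma det_eq_ofReal_of_posDef {S : Matrix (Fin N) (Fin N) ℂ} (hS : S.PosDef) :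
    S.det = (S.det.re : ℂ) :=
  Complex.ext rfl (by rw [Complex.ofReal_im]; exact (Complex.pos_iff.1 hS.det_pos).2.symm)

lemma posDef_whiteningS (hQ : Q.PosSemidef) : (whiteningS F G σ Q).PosDef := by
  have hd := posDef_det_re_pos (posDef_outputCov F G σ hQ)
  exact (posDef_outputCov F G σ hQ).inv.smul
    (Complex.zero_lt_real.2 (Real.rpow_pos_of_pos hd _))

lemma beta_whiteningS (hN : 1 ≤ N) (hQ : Q.PosSemidef) :
    beta F G σ N Q (whiteningS F G σ Q) = (outputCov F G σ Q).det.re ^ (1 / (N : ℝ)) := by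
  have hN' : (N : ℝ) ≠ 0 := by positivity
  have hu : IsUnit (outputCov F G σ Q).det :=
    (Matrix.isUnit_iff_isUnit_det _).1 (posDef_outputCov F G σ hQ).isUnit
  rw [beta, whiteningS, smul_mul_assoc, Matrix.nonsing_inv_mul _ hu, Matrix.trace_smul,
    Matrix.trace_one, smul_eq_mul, Complex.re_ofReal_mul, Fintype.card_fin, Complex.natCast_re]
  field_simp

lemma det_whiteningS (hN : 1 ≤ N) (hQ : Q.PosSemidef) : (whiteningS F G σ Q).det = 1 := by
  have hN' : N ≠ 0 := by omega
  have hpd := posDef_outputCov F G σ hQ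
  have hd := posDef_det_re_pos hpd
  rw [whiteningS, Matrix.det_smul, Fintype.card_fin, Matrix.det_nonsing_inv,
    Ring.inverse_eq_inv', ← Complex.ofReal_pow, one_div, Real.rpow_inv_natCast_pow hd.le hN',
    ← det_eq_ofReal_of_posDef hpd, mul_inv_cancel₀ hpd.det_pos.ne']

/-- For `α = N` the numerator is `1`, so every value is at most `0`, with equality at `x = 0`, which
lies in the ball because `r ≥ 0`. -/
lemma iSup_log_one_div {r : ℝ} (hr : 0 ≤ r) (S : Matrix (Fin N) (Fin N) ℂ) :
    ⨆ x : Metric.closedBall (0 : EuclideanSpace ℂ (Fin N)) r,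
        Real.log (gam F G σ S x ^ ((N : ℝ) - N) /
          (1 + σ ^ 2 * ‖Matrix.toEuclideanLin G (x : EuclideanSpace ℂ (Fin N))‖ ^ 2)) = 0 := by
  have hle : ∀ x : Metric.closedBall (0 : EuclideanSpace ℂ (Fin N)) r,
      Real.log (gam F G σ S x ^ ((N : ℝ) - N) /
          (1 + σ ^ 2 * ‖Matrix.toEuclideanLin G (x : EuclideanSpace ℂ (Fin N))‖ ^ 2)) ≤ 0 := by
    intro x
    rw [sub_self, Real.rpow_zero]
    refine Real.log_nonpos (by positivity) (div_le_one_of_le₀ ?_ (by positivity))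
    have := mul_nonneg (sq_nonneg σ)
      (sq_nonneg ‖Matrix.toEuclideanLin G (x : EuclideanSpace ℂ (Fin N))‖)
    linarith
  refine le_antisymm (Real.iSup_nonpos hle) ?_
  have hbdd : BddAbove (Set.range fun x : Metric.closedBall (0 : EuclideanSpace ℂ (Fin N)) r =>
      Real.log (gam F G σ S x ^ ((N : ℝ) - N) /
        (1 + σ ^ 2 * ‖Matrix.toEuclideanLin G (x : EuclideanSpace ℂ (Fin N))‖ ^ 2))) :=
    ⟨0, by rintro _ ⟨x, rfl⟩; exact hle x⟩
  refine le_trans (le_of_eq ?_) (le_ciSup hbdd ⟨0, Metric.mem_closedBall_self hr⟩)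
  simp

lemma rateUB_whiteningS (hN : 1 ≤ N) {r : ℝ} (hr : 0 ≤ r) (hQ : Q.PosSemidef) :
    rateUB F G σ r N (whiteningS F G σ Q) Q
      = N * Real.log (beta F G σ N Q (whiteningS F G σ Q)) := by
  have hG : Real.Gamma N ≠ 0 := (Real.Gamma_pos_of_pos (by exact_mod_cast hN)).ne'
  rw [rateUB, iSup_log_one_div F G σ hr, det_whiteningS F G σ hN hQ, div_self hG]
  simp

lemma mul_log_beta_whiteningS (hN : 1 ≤ N) (hQ : Q.PosSemidef) :
    N * Real.log (beta F G σ N Q (whiteningS F G σ Q)) = logDetUB F G σ Q := by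
  have hN' : (N : ℝ) ≠ 0 := by positivity
  have hd := posDef_det_re_pos (posDef_outputCov F G σ hQ)
  rw [beta_whiteningS F G σ hN hQ, Real.log_rpow hd, logDetUB]
  field_simp

end Whitening

/-! ### From input laws to capacities -/

/-- A real `⨆` dominates its terms only when the range is bounded; here continuity on a compact ball
ensures it. -/
lemma bddAbove_range_log_gam (hN : 1 ≤ N) (F G : Matrix (Fin N) (Fin N) ℂ) (σ r α : ℝ)
    {S : Matrix (Fin N) (Fin N) ℂ} (hS : S.PosDef) :
    BddAbove (Set.range fun x : Metric.closedBall (0 : EuclideanSpace ℂ (Fin N)) r =>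
      Real.log (gam F G σ S x ^ ((N : ℝ) - α) /
        (1 + σ ^ 2 * ‖Matrix.toEuclideanLin G (x : EuclideanSpace ℂ (Fin N))‖ ^ 2))) := by
  have hg0 : ∀ x, 0 < gam F G σ S x := fun x =>
    (trace_re_pos hN hS).trans_le (trace_re_le_gam F G σ hS.posSemidef x)
  have hd0 : ∀ x, 0 < 1 + σ ^ 2 * ‖Matrix.toEuclideanLin G x‖ ^ 2 :=
    fun x => one_add_sq_mul_norm_sq_pos σ _
  have hc : Continuous fun x => Real.log (gam F G σ S x ^ ((N : ℝ) - α) /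
        (1 + σ ^ 2 * ‖Matrix.toEuclideanLin G x‖ ^ 2)) := by
    refine Continuous.log (Continuous.div ?_ ?_ fun x => (hd0 x).ne') fun x =>
      (div_pos (Real.rpow_pos_of_pos (hg0 x) _) (hd0 x)).ne'
    · exact (continuous_gam F G σ S).rpow_const fun x => Or.inl (hg0 x).ne'
    · exact continuous_const.add (continuous_const.mul ((continuous_toEuclideanLin G).norm.pow 2))
  have : CompactSpace (Metric.closedBall (0 : EuclideanSpace ℂ (Fin N)) r) :=
    isCompact_iff_compactSpace.1 (isCompact_closedBall 0 r)
  exact (isCompact_range (hc.comp continuous_subtype_val)).bddAbove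

lemma dirac_zero_mem_inputLaws (P : ℝ) : Measure.dirac 0 ∈ inputLaws N P :=
  ⟨inferInstance, by simp⟩

/-- Nonemptiness forces `0 ≤ M`: an empty supremum in `ℝ≥0∞` is `0`, which a negative `M` would not
bound. -/
lemma coe_biSup_le_of_forall {ι : Type*} {s : Set ι} (hs : s.Nonempty) {f : ι → ℝ≥0∞}
    {M : EReal} (h : ∀ i ∈ s, (f i : EReal) ≤ M) : ((⨆ i ∈ s, f i : ℝ≥0∞) : EReal) ≤ M := by
  obtain ⟨i, hi⟩ := hs
  have hM : 0 ≤ M := (EReal.coe_ennreal_nonneg _).trans (h i hi)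
  rw [← EReal.coe_toENNReal hM] at h ⊢
  exact EReal.coe_ennreal_le_coe_ennreal_iff.2
    (iSup₂_le fun j hj => EReal.coe_ennreal_le_coe_ennreal_iff.1 (h j hj))

lemma coe_mutualInfo_le_infRateUB (hN : 1 ≤ N) (F G : Matrix (Fin N) (Fin N) ℂ) (σ r : ℝ) {P : ℝ}
    {μ : Measure (EuclideanSpace ℂ (Fin N))} (hμ : μ ∈ inputLaws N P)
    (hr : ∀ᵐ x ∂μ, ‖x‖ ≤ r) :
    (mutualInfo (jointLaw F G σ μ) : EReal) ≤ infRateUB F G σ r (inputCov μ) := by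
  refine le_iInf₂ fun α hα => le_iInf₂ fun S hS => ?_
  have hS' : S.PosDef := hS
  obtain ⟨h0, hle⟩ := mutualInfo_jointLaw_le hN F G σ hμ hα.1 hα.2 hS'
    (B := ⨆ x : Metric.closedBall (0 : EuclideanSpace ℂ (Fin N)) r,
        Real.log (gam F G σ S x ^ ((N : ℝ) - α) /
          (1 + σ ^ 2 * ‖Matrix.toEuclideanLin G (x : EuclideanSpace ℂ (Fin N))‖ ^ 2)))
    (hr.mono fun x hx => le_ciSup (bddAbove_range_log_gam hN F G σ r α hS')
      ⟨x, mem_closedBall_zero_iff.2 hx⟩) (V := rateUB F G σ r α S (inputCov μ)) rfl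
  calc (mutualInfo (jointLaw F G σ μ) : EReal)
      ≤ ((ENNReal.ofReal (rateUB F G σ r α S (inputCov μ)) : ℝ≥0∞) : EReal) :=
        EReal.coe_ennreal_le_coe_ennreal_iff.2 hle
    -- Nonnegativity of the bound ensures that `ENNReal.ofReal` truncates nothing.
    _ = _ := by rw [EReal.coe_ennreal_ofReal, max_eq_left h0]

/-- With `α = N` the constant `B = 0` works for all `x`, so unbounded inputs are allowed. -/
lemma coe_mutualInfo_le_logDetUB (hN : 1 ≤ N) (F G : Matrix (Fin N) (Fin N) ℂ) (σ : ℝ) {P : ℝ}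
    {μ : Measure (EuclideanSpace ℂ (Fin N))} (hμ : μ ∈ inputLaws N P) :
    (mutualInfo (jointLaw F G σ μ) : EReal) ≤ (logDetUB F G σ (inputCov μ) : EReal) := by
  have hQ := posSemidef_inputCov hμ
  have hG : Real.Gamma N ≠ 0 := (Real.Gamma_pos_of_pos (by exact_mod_cast hN)).ne'
  obtain ⟨h0, hle⟩ := mutualInfo_jointLaw_le hN F G σ hμ (α := N) (by exact_mod_cast hN) le_rfl
    (posDef_whiteningS F G σ hQ) (B := 0) (Filter.Eventually.of_forall fun x => by
      rw [sub_self, Real.rpow_zero]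
      refine Real.log_nonpos (by positivity) (div_le_one_of_le₀ ?_ (by positivity))
      have := mul_nonneg (sq_nonneg σ) (sq_nonneg ‖Matrix.toEuclideanLin G x‖)
      linarith) (V := logDetUB F G σ (inputCov μ)) (by
      rw [mul_log_beta_whiteningS F G σ hN hQ, det_whiteningS F G σ hN hQ, div_self hG]
      simp)
  calc (mutualInfo (jointLaw F G σ μ) : EReal)
      ≤ ((ENNReal.ofReal (logDetUB F G σ (inputCov μ)) : ℝ≥0∞) : EReal) :=
        EReal.coe_ennreal_le_coe_ennreal_iff.2 hle
    _ = _ := by rw [EReal.coe_ennreal_ofReal, max_eq_left h0]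

end DopplerChannel

theorem mainTheorem2 {N : ℕ} (hN : 1 ≤ N) (F G : Matrix (Fin N) (Fin N) ℂ) (σ : ℝ)
    (P : ℝ) (hP : 0 ≤ P) (r : ℝ) (hr : 0 ≤ r) :
    (∃ M : EReal,
      IsGreatest (DopplerChannel.infRateUB F G σ r '' DopplerChannel.covariances N P) M ∧
      (DopplerChannel.capacityBall F G σ P r : EReal) ≤ M) ∧
    (∀ Q ∈ DopplerChannel.covariances N P,
      (DopplerChannel.whiteningS F G σ Q).PosDef ∧
      DopplerChannel.rateUB F G σ r N (DopplerChannel.whiteningS F G σ Q) Q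
        = N * Real.log (DopplerChannel.beta F G σ N Q (DopplerChannel.whiteningS F G σ Q)) ∧
      DopplerChannel.rateUB F G σ r N (DopplerChannel.whiteningS F G σ Q) Q
        = DopplerChannel.logDetUB F G σ Q) ∧
    (∃ M : ℝ,
      IsGreatest (DopplerChannel.logDetUB F G σ '' DopplerChannel.covariances N P) M ∧
      (DopplerChannel.capacity F G σ P : EReal) ≤ (M : EReal)) := by
  refine ⟨?_, fun Q hQ => ⟨DopplerChannel.posDef_whiteningS F G σ hQ.1,
    DopplerChannel.rateUB_whiteningS F G σ hN hr hQ.1,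
    (DopplerChannel.rateUB_whiteningS F G σ hN hr hQ.1).trans
      (DopplerChannel.mul_log_beta_whiteningS F G σ hN hQ.1)⟩, ?_⟩
  · obtain ⟨M, hM⟩ := DopplerChannel.exists_isGreatest_infRateUB hN F G σ r hP
    have h0 : ∀ᵐ x ∂(Measure.dirac (0 : EuclideanSpace ℂ (Fin N))), ‖x‖ ≤ r := by
      simpa [ae_dirac_eq] using hr
    exact ⟨M, hM, DopplerChannel.coe_biSup_le_of_forall
      (s := {μ | μ ∈ DopplerChannel.inputLaws N P ∧ ∀ᵐ x ∂μ, ‖x‖ ≤ r})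
      ⟨_, DopplerChannel.dirac_zero_mem_inputLaws P, h0⟩ fun μ hμ =>
      (DopplerChannel.coe_mutualInfo_le_infRateUB hN F G σ r hμ.1 hμ.2).trans
        (hM.2 ⟨_, DopplerChannel.inputCov_mem_covariances hP hμ.1, rfl⟩)⟩
  · obtain ⟨M, hM⟩ := DopplerChannel.exists_isGreatest_logDetUB F G σ hP
    exact ⟨M, hM, DopplerChannel.coe_biSup_le_of_forall
      ⟨_, DopplerChannel.dirac_zero_mem_inputLaws P⟩ fun μ hμ =>
      (DopplerChannel.coe_mutualInfo_le_logDetUB hN F G σ hμ).trans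
        (EReal.coe_le_coe_iff.2
          (hM.2 ⟨_, DopplerChannel.inputCov_mem_covariances hP hμ, rfl⟩))⟩
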